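/- Let $\Pi$ be the Szegő projector on the circle $\mathbb S^1$, $\Pi\big(\sum_{k\in\mathbb Z}\hat u(k)e^{ikx}\big)=\sum_{k\ge 0}\hat u(k)e^{ikx}$, let $L^2_+=\Pi(L^2(\mathbb S^1))$, let $\|u\|_{H^s}^2=\sum_{k}(1+k^2)^s|\hat u(k)|^2$, and let $H^{1/2}_+=H^{1/2}(\mathbb S^1)\cap L^2_+$. For $u\in H^{1/2}_+$ let $K_u$ be the shifted Hankel operator on $L^2_+$, $K_u h=\Pi\big(\bar z\,\Pi(u\bar h)\big)$, and let $\mathcal L(1)=\{u\in H^{1/2}_+:\ \operatorname{rk}K_u=1\}$; equivalently, $\mathcal L(1)$ is the set of functions $u=b+\frac{cz}{1-pz}$ with $b,c,p\in\mathbb C$, $c\neq0$, $|p|<1$. There is an absolute constant $\delta>0$ such that for every $\alpha>0$ and every $u_0\in\mathcal L(1)$ with $\|u_0\|_{H^{1/2}}\le\delta\sqrt\alpha$, the following holds. The equation $$i\,\partial_t u=\Pi(|u|^2u)+\alpha\,(u\,|\,1),\qquad (u\,|\,1)=\frac1{2\pi}\int_{-\pi}^{\pi}u(e^{ix})\,dx,\qquad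 u(0)=u_0,$$ has a unique global solution $u\in C(\mathbb R;H^{1/2}_+)$, the equation being satisfied at every time with the time derivative taken in $L^2$. For every $t\in\mathbb R$ (in particular for $t=0$) there are $b,c,p\in\mathbb C$ with $c\ne0$, $|p|<1$, $u(t)=b+\frac{cz}{1-pz}$ and $$\Big|\,b+\frac{\bar p\,c}{1-|p|^2}\Big|\neq\sqrt\alpha .$$ Moreover, all Sobolev norms stay bounded: $\sup_{t\in\mathbb R}\|u(t)\|_{H^s}<\infty$ for every real $s$ (in particular for every $s>\frac12$). -/

import Mathlib

noncomputable section

namespace AlphaSzego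

open MeasureTheory AddCircle Filter Topology
open scoped ENNReal

/-- The period `2π` is positive. -/
instance factTwoPiPos : Fact (0 < 2 * Real.pi) := ⟨Real.two_pi_pos⟩

/-- The circle `𝕊¹`, parametrized by the angle `x ∈ ℝ / 2πℤ`, the point being `z = e^{ix}`. -/
abbrev Torus : Type := AddCircle (2 * Real.pi)

/-- `L²(𝕊¹)` with respect to the normalized measure `dx / 2π`. -/
abbrev L2 : Type := Lp ℂ 2 (haarAddCircle : Measure Torus)

/-- The Hardy space `L²₊`: the elements of `L²` whose negative Fourier coefficients vanish. -/
def hardy : Set L2 := {u | ∀ n : ℤ, n < 0 → fourierCoeff (u : Torus → ℂ) n = 0}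

/-- The Sobolev norm `‖u‖_{H^s} = (∑ₙ (1 + n²)^s |û(n)|²)^{1/2}`, with value `∞` if `u ∉ H^s`. -/
def sobolevNorm (s : ℝ) (u : L2) : ℝ≥0∞ :=
  (∑' n : ℤ, ENNReal.ofReal
    ((1 + (n : ℝ) ^ 2) ^ s * ‖fourierCoeff (u : Torus → ℂ) n‖ ^ 2)) ^ (1 / 2 : ℝ)

/-- `H^{1/2}₊ = H^{1/2} ∩ L²₊`. -/
def HHalfPlus : Set L2 := {u | u ∈ hardy ∧ sobolevNorm (1 / 2) u < ∞}

/-- `Π f = g`: the function `f` is integrable and `g ∈ L²` is its Szegő projection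
`∑_{n ≥ 0} f̂(n) e^{inx}`. -/
def IsSzegoProj (f : Torus → ℂ) (g : L2) : Prop :=
  Integrable f haarAddCircle ∧
    ∀ n : ℤ, fourierCoeff (g : Torus → ℂ) n = if 0 ≤ n then fourierCoeff f n else 0

/-- `H_u h = g` for the Hankel operator `H_u h = Π (u h̄)`. -/
def IsHankel (u h g : L2) : Prop :=
  IsSzegoProj (fun x => u x * starRingEnd ℂ (h x)) g

/-- `K_u h = k` for the shifted Hankel operator `K_u = T_z^* H_u`, where `T_z^* g = Π (z̄ g)`. -/
def IsShiftedHankel (u h k : L2) : Prop :=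
  ∃ g : L2, IsHankel u h g ∧ IsSzegoProj (fun x => starRingEnd ℂ (fourier 1 x) * g x) k

/-- The rank of `K_u : L²₊ → L²₊`, i.e. the dimension of its range. -/
def rankK (u : L2) : Cardinal :=
  Module.rank ℂ (Submodule.span ℂ {k : L2 | ∃ h ∈ hardy, IsShiftedHankel u h k})

/-- The manifold `𝓛(k) = {u ∈ H^{1/2}₊ : rk K_u = k}`. -/
def calL (k : ℕ) : Set L2 := {u | u ∈ HHalfPlus ∧ rankK u = k}

/-- The mean value `(u | 1) = (1 / 2π) ∫ u(e^{ix}) dx`. -/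
def mean (u : L2) : ℂ := ∫ x, u x ∂haarAddCircle

/-- The constant function `1` as an element of `L²`. -/
def one : L2 := Lp.const 2 (haarAddCircle : Measure Torus) (1 : ℂ)

/-- `u ∈ C(ℝ; H^{1/2}₊)` is a global solution of `i ∂ₜ u = Π(|u|² u) + α (u | 1)`, `u(0) = u₀`,
the time derivative being taken in `L²`. -/
structure IsGlobalSolution (α : ℝ) (u₀ : L2) (u : ℝ → L2) : Prop where
  mem : ∀ t, u t ∈ HHalfPlus
  cont : ∀ t₀, Tendsto (fun t => sobolevNorm (1 / 2) (u t - u t₀)) (𝓝 t₀) (𝓝 0)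
  eqn : ∀ t, ∃ N du : L2, IsSzegoProj (fun x => (‖u t x‖ : ℂ) ^ 2 * u t x) N ∧
    HasDerivAt u du t ∧ Complex.I • du = N + ((α : ℂ) * mean (u t)) • one
  init : u 0 = u₀

/-- `u = b + c z / (1 - p z)` on the circle. -/
def IsRational (u : L2) (b c p : ℂ) : Prop :=
  (u : Torus → ℂ) =ᵐ[haarAddCircle] fun x => b + c * fourier 1 x / (1 - p * fourier 1 x)

end AlphaSzego

end

noncomputable section

namespace AlphaSzego

open MeasureTheory AddCircle Filter Topology
open scoped ENNReal

/-! ### Fourier coefficients on `L²` and trigonometric polynomials -/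

/-! The flow preserves the functions `b + cz/(1 - pz)`, so existence reduces to an ODE for `(b, c,
p)`, and boundedness of all Sobolev norms to keeping `|p|` away from `1`. In `|u|²u` the conjugate
of `z` is `1/z`; a partial fraction expansion (`cubic_rational_identity`) separates the pole outside
the disk, whose part is `Π(|u|²u)`, from the pole at `p̄`, which carries only negative frequencies.
Since `l = |c|/(1 - |p|²)` is conserved, it can be frozen as a parameter, and the vector field
`field` becomes polynomial.

Put `x = 1 - |p|²`. Conservation of the mass `Q = |b|² + l²x` and of the Hamiltonian gives a
constant `C = x(-2α + 2Q + 2l² - 4l²x) + 4 Re(b c̄ p)`. As `|c| = lx`, every term carries a factor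
`x`, and for small data `-2αx` dominates. Hence `C` is negative and comparable to `-αx(t)` at all
times, so `x(t)` stays comparable to `x(0)` (`reduced_bounds`). Then `|p(t)| ≤ R < 1`, the Fourier
coefficients decay geometrically uniformly in time, and every `H^s` norm is bounded. The quantity `b
+ p̄c/(1 - |p|²)` is `u(p̄)`, of modulus at most `√α/2`.

Uniqueness holds among all `H^{1/2}` solutions, which need not be bounded functions. It suffices
that one of the two solutions, the rational one, is bounded: the `L²` norm of the difference is
controlled by a Yudovich-type argument, using a sup bound of size `√(log M)` for frequencies below
`M` and a gain `M^{-1/2}` for the tail, then Grönwall with `M → ∞` (`IsGlobalSolution.unique`). -/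

/-- The `n`-th Fourier coefficient as a continuous linear functional on `L²`. -/
def coeffL (n : ℤ) : L2 →L[ℂ] ℂ := innerSL ℂ (fourierBasis n : L2)

theorem coeffL_apply (n : ℤ) (u : L2) : coeffL n u = fourierCoeff (u : Torus → ℂ) n := by
  rw [← fourierBasis_repr, HilbertBasis.repr_apply_apply]; rfl

theorem ext_coeffL {u v : L2} (h : ∀ n, coeffL n u = coeffL n v) : u = v := by
  apply fourierBasis.repr.injective
  ext n
  simpa [HilbertBasis.repr_apply_apply, coeffL] using h n

theorem mem_hardy {u : L2} : u ∈ hardy ↔ ∀ n : ℤ, n < 0 → coeffL n u = 0 := by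
  simp [hardy, coeffL_apply]

theorem hasSum_norm_sq_coeffL (u : L2) : HasSum (fun n => ‖coeffL n u‖ ^ 2) (‖u‖ ^ 2) := by
  have h := fourierBasis.hasSum_inner_mul_inner u u
  rw [inner_self_eq_norm_sq_to_K] at h
  have h2 : ∀ n : ℤ, inner ℂ u (fourierBasis n) * inner ℂ (fourierBasis n) u
      = ((‖coeffL n u‖ ^ 2 : ℝ) : ℂ) := by
    intro n
    rw [← inner_conj_symm, Complex.conj_mul']
    simp [coeffL]
  simp only [h2] at h
  have h3 : ((‖u‖ : ℂ)) ^ 2 = ((‖u‖ ^ 2 : ℝ) : ℂ) := by push_cast; rfl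
  have h' : HasSum (fun n => ((‖coeffL n u‖ ^ 2 : ℝ) : ℂ)) ((‖u‖ ^ 2 : ℝ) : ℂ) := by
    rw [← h3]; exact h
  exact Complex.hasSum_ofReal.mp h'

/-- A function on `ℤ` supported on `ℕ` is summed over `ℕ`. -/
theorem hasSum_nat_of_int {f : ℤ → ℝ} {a : ℝ} (hf : ∀ n : ℤ, n < 0 → f n = 0) (h : HasSum f a) :
    HasSum (fun n : ℕ => f n) a := by
  refine (Function.Injective.hasSum_iff Nat.cast_injective ?_).mpr h
  intro n hn
  apply hf
  by_contra hc
  exact hn ⟨n.toNat, by simp; omega⟩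

theorem hasSum_norm_sq_hardy {u : L2} (hu : u ∈ hardy) :
    HasSum (fun n : ℕ => ‖coeffL n u‖ ^ 2) (‖u‖ ^ 2) := by
  refine hasSum_nat_of_int (f := fun n => ‖coeffL n u‖ ^ 2) ?_ (hasSum_norm_sq_coeffL u)
  intro n hn
  simp [mem_hardy.mp hu n hn]

theorem hardy_sub {u v : L2} (hu : u ∈ hardy) (hv : v ∈ hardy) : u - v ∈ hardy := by
  rw [mem_hardy] at *
  intro n hn
  simp [hu n hn, hv n hn]

theorem integrable_continuousMap (f : C(Torus, ℂ)) : Integrable f haarAddCircle :=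
  f.continuous.integrable_of_hasCompactSupport (HasCompactSupport.of_compactSpace f)

/-- The class in `L²` of a continuous function. -/
def toL2 : C(Torus, ℂ) →L[ℂ] L2 := ContinuousMap.toLp 2 haarAddCircle ℂ

theorem coe_toL2 (f : C(Torus, ℂ)) : (toL2 f : Torus → ℂ) =ᵐ[haarAddCircle] f :=
  ContinuousMap.coeFn_toLp _ _

theorem coeffL_toL2 (f : C(Torus, ℂ)) (n : ℤ) : coeffL n (toL2 f) = fourierCoeff f n := by
  rw [coeffL_apply]; exact fourierCoeff_toLp f n

theorem fourierCoeff_fourier_mul (f : Torus → ℂ) (m n : ℤ) :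
    fourierCoeff (fun x => fourier m x * f x) n = fourierCoeff f (n - m) := by
  unfold fourierCoeff
  congr 1
  ext x
  simp only [smul_eq_mul]
  rw [← mul_assoc, ← fourier_add]
  congr 3
  ring

theorem fourierCoeff_conj (f : Torus → ℂ) (n : ℤ) :
    fourierCoeff (fun x => starRingEnd ℂ (f x)) n = starRingEnd ℂ (fourierCoeff f (-n)) := by
  unfold fourierCoeff
  rw [← integral_conj]
  congr 1
  ext x
  simp only [smul_eq_mul, map_mul, neg_neg, fourier_neg]

/-- The trigonometric polynomial `x ↦ P(e^{ix})`. -/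
def trigPoly (P : Polynomial ℂ) : C(Torus, ℂ) := Polynomial.aeval (fourier 1 : C(Torus, ℂ)) P

theorem fourier_one_pow (k : ℕ) : (fourier 1 : C(Torus, ℂ)) ^ k = fourier (k : ℤ) := by
  induction k with
  | zero => ext x; simp
  | succ k ih => rw [pow_succ, ih]; ext x; push_cast; rw [fourier_add]; rfl

theorem coeffL_trigPoly (P : Polynomial ℂ) (n : ℤ) :
    coeffL n (toL2 (trigPoly P)) = if 0 ≤ n then P.coeff n.toNat else 0 := by
  induction P using Polynomial.induction_on' with
  | add p q hp hq =>
    rw [trigPoly, map_add, map_add, map_add]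
    rw [trigPoly] at hp hq
    rw [hp, hq]
    split_ifs <;> simp
  | monomial k a =>
    rw [trigPoly, Polynomial.aeval_monomial, fourier_one_pow, Polynomial.coeff_monomial,
      ← Algebra.smul_def, map_smul, map_smul, coeffL_toL2, fourierCoeff_fourier]
    by_cases h : (k : ℤ) = n
    · subst h; simp
    · have : ∀ h0 : 0 ≤ n, k ≠ n.toNat := by intro h0 h1; omega
      rw [Pi.single_apply, if_neg (Ne.symm h)]
      split_ifs with h1 h2
      · exact absurd h2 (this h1)
      · simp
      · simp

theorem coeffL_trigPoly_nat (P : Polynomial ℂ) (n : ℕ) :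
    coeffL n (toL2 (trigPoly P)) = P.coeff n := by
  simp [coeffL_trigPoly]

theorem trigPoly_mem_hardy (P : Polynomial ℂ) : toL2 (trigPoly P) ∈ hardy := by
  rw [mem_hardy]
  intro n hn
  rw [coeffL_trigPoly, if_neg (by omega)]

theorem norm_sq_trigPoly (P : Polynomial ℂ) :
    ‖toL2 (trigPoly P)‖ ^ 2 = ∑ k ∈ Finset.range (P.natDegree + 1), ‖P.coeff k‖ ^ 2 := by
  refine (hasSum_norm_sq_hardy (trigPoly_mem_hardy P)).unique ?_
  simp only [coeffL_trigPoly_nat]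
  apply hasSum_sum_of_ne_finset_zero
  intro k hk
  rw [Polynomial.coeff_eq_zero_of_natDegree_lt (by simpa using hk)]
  simp

/-! ### The embedding `H^{1/2}₊ ⊂ L⁴` -/

/-- This is the `L⁴` bound in coefficient form, as `‖P‖₄⁴ = ‖P²‖₂²`. Cauchy–Schwarz on the `n + 1`
pairs `j + k = n` costs a factor `n + 1 ≤ (j + 1)(k + 1)`, which the weights absorb. -/
theorem sum_norm_sq_coeff_sq_le (P : Polynomial ℂ) :
    ∑ n ∈ Finset.range ((P ^ 2).natDegree + 1), ‖(P ^ 2).coeff n‖ ^ 2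
      ≤ (∑ k ∈ Finset.range (P.natDegree + 1), ((k : ℝ) + 1) * ‖P.coeff k‖ ^ 2) ^ 2 := by
  classical
  set w : ℕ → ℝ := fun k => ((k : ℝ) + 1) * ‖P.coeff k‖ ^ 2 with hw
  -- The weights become the coefficients of a polynomial, so that summing their self-convolution is
  -- evaluating `R ^ 2` at `1`.
  set R : Polynomial ℝ := ∑ k ∈ Finset.range (P.natDegree + 1), Polynomial.monomial k (w k) with hR
  have hRc : ∀ k, R.coeff k = w k := by
    intro k
    simp only [hR, Polynomial.finsetSum_coeff, Polynomial.coeff_monomial]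
    rw [Finset.sum_ite_eq']
    split_ifs with h
    · rfl
    · simp only [hw]
      rw [Polynomial.coeff_eq_zero_of_natDegree_lt (by simpa using h)]
      simp
  have hRe : R.eval 1 = ∑ k ∈ Finset.range (P.natDegree + 1), w k := by
    simp [hR, Polynomial.eval_finsetSum]
  have hRd : R.natDegree ≤ P.natDegree := by
    rw [Polynomial.natDegree_le_iff_coeff_eq_zero]
    intro N hN
    rw [hRc]
    simp [hw, Polynomial.coeff_eq_zero_of_natDegree_lt hN]
  have hR2 : (R ^ 2).natDegree < 2 * P.natDegree + 1 := by
    have := Polynomial.natDegree_pow_le (p := R) (n := 2)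
    omega
  rw [← hRe, ← Polynomial.eval_pow, Polynomial.eval_eq_sum_range' hR2]
  have hterm : ∀ n, ‖(P ^ 2).coeff n‖ ^ 2 ≤ (R ^ 2).coeff n * 1 ^ n := by
    intro n
    rw [one_pow, mul_one, pow_two P, pow_two R, Polynomial.coeff_mul, Polynomial.coeff_mul]
    calc ‖∑ x ∈ Finset.HasAntidiagonal.antidiagonal n, P.coeff x.1 * P.coeff x.2‖ ^ 2
        ≤ (∑ x ∈ Finset.HasAntidiagonal.antidiagonal n, ‖P.coeff x.1‖ * ‖P.coeff x.2‖) ^ 2 := by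
          gcongr
          refine (norm_sum_le _ _).trans (le_of_eq ?_)
          simp
      _ ≤ ((Finset.HasAntidiagonal.antidiagonal n).card : ℝ)
            * ∑ x ∈ Finset.HasAntidiagonal.antidiagonal n, (‖P.coeff x.1‖ * ‖P.coeff x.2‖) ^ 2 :=
          sq_sum_le_card_mul_sum_sq
      _ = ∑ x ∈ Finset.HasAntidiagonal.antidiagonal n, ((n : ℝ) + 1) * (‖P.coeff x.1‖ * ‖P.coeff x.2‖) ^ 2 := by
          rw [Finset.Nat.card_antidiagonal, Finset.mul_sum]; push_cast; rfl
      _ ≤ ∑ x ∈ Finset.HasAntidiagonal.antidiagonal n, R.coeff x.1 * R.coeff x.2 := by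
          refine Finset.sum_le_sum fun x hx => ?_
          have hx' : (x.1 : ℝ) + x.2 = n := by exact_mod_cast Finset.HasAntidiagonal.mem_antidiagonal.mp hx
          have e : R.coeff x.1 * R.coeff x.2
              = (((x.1 : ℝ) + 1) * (x.2 + 1)) * (‖P.coeff x.1‖ * ‖P.coeff x.2‖) ^ 2 := by
            rw [hRc, hRc]; simp only [hw]; ring
          rw [e, ← hx']
          gcongr
          nlinarith [mul_nonneg (Nat.cast_nonneg (α := ℝ) x.1) (Nat.cast_nonneg (α := ℝ) x.2)]
  refine (Finset.sum_le_sum_of_subset_of_nonneg ?_ fun _ _ _ => by positivity).trans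
    (Finset.sum_le_sum fun n _ => hterm n)
  apply Finset.range_subset_range.mpr
  have := Polynomial.natDegree_pow_le (p := P) (n := 2)
  omega

theorem eLpNorm_four_sq (f : Torus → ℂ) :
    eLpNorm f 4 haarAddCircle ^ 2 = eLpNorm (fun x => f x ^ 2) 2 haarAddCircle := by
  have h := eLpNorm_norm_rpow (p := 2) (μ := haarAddCircle) f (q := 2) (by norm_num)
  have e : (2 : ℝ≥0∞) * ENNReal.ofReal 2 = 4 := by
    rw [ENNReal.ofReal_ofNat]; norm_num
  rw [e] at h
  rw [← ENNReal.rpow_natCast]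
  push_cast
  rw [← h, ← eLpNorm_norm (fun x => f x ^ 2)]
  simp

theorem eLpNorm_trigPoly_four (P : Polynomial ℂ) :
    eLpNorm (trigPoly P) 4 haarAddCircle ^ 2 ≤
      ENNReal.ofReal (∑ k ∈ Finset.range (P.natDegree + 1), ((k : ℝ) + 1) * ‖P.coeff k‖ ^ 2) := by
  rw [eLpNorm_four_sq]
  have h1 : (fun x => trigPoly P x ^ 2) = trigPoly (P ^ 2) := by
    ext x; simp [trigPoly]
  rw [h1, ← eLpNorm_congr_ae (coe_toL2 _), ← Lp.enorm_def, ← ofReal_norm]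
  apply ENNReal.ofReal_le_ofReal
  refine le_of_sq_le_sq ?_ (Finset.sum_nonneg fun _ _ => by positivity)
  rw [norm_sq_trigPoly]
  exact sum_norm_sq_coeff_sq_le P

/-- The quantity `∑ (n + 1) |û(n)|²` is finite. -/
def HasEnergy (u : L2) : Prop := Summable fun n : ℕ => ((n : ℝ) + 1) * ‖coeffL n u‖ ^ 2

/-- The square `∑ (n + 1) |û(n)|²` of a norm on `H^{1/2}₊`. -/
def energy (u : L2) : ℝ := ∑' n : ℕ, ((n : ℝ) + 1) * ‖coeffL n u‖ ^ 2

theorem energy_nonneg (u : L2) : 0 ≤ energy u := tsum_nonneg fun _ => by positivity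

/-- The polynomial with coefficients `û(k)`, `k < M`. -/
def truncPoly (M : ℕ) (u : L2) : Polynomial ℂ :=
  ∑ k ∈ Finset.range M, Polynomial.monomial k (coeffL k u)

theorem coeff_truncPoly (M : ℕ) (u : L2) (k : ℕ) :
    (truncPoly M u).coeff k = if k < M then coeffL k u else 0 := by
  simp only [truncPoly, Polynomial.finsetSum_coeff, Polynomial.coeff_monomial,
    Finset.sum_ite_eq', Finset.mem_range]

/-- The partial sum `∑_{k < M} û(k) e^{ikx}`. -/
def lowPass (M : ℕ) (u : L2) : C(Torus, ℂ) := trigPoly (truncPoly M u)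

theorem coeffL_lowPass (M : ℕ) (u : L2) (n : ℕ) :
    coeffL n (toL2 (lowPass M u)) = if n < M then coeffL n u else 0 := by
  rw [lowPass, coeffL_trigPoly_nat, coeff_truncPoly]

theorem lowPass_mem_hardy (M : ℕ) (u : L2) : toL2 (lowPass M u) ∈ hardy := trigPoly_mem_hardy _

theorem norm_sq_sub_lowPass_le {u : L2} (hu : u ∈ hardy) (he : HasEnergy u) (M : ℕ) :
    ‖u - toL2 (lowPass M u)‖ ^ 2 ≤ energy u / (M + 1) := by
  have h := hasSum_norm_sq_hardy (hardy_sub hu (lowPass_mem_hardy M u))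
  have h2 : HasSum (fun n : ℕ => (((n : ℝ) + 1) * ‖coeffL n u‖ ^ 2) / (M + 1))
      (energy u / (M + 1)) := (he.hasSum).div_const _
  refine hasSum_le (fun n => ?_) h h2
  rw [map_sub, coeffL_lowPass]
  split_ifs with hn
  · simp; positivity
  · rw [sub_zero, le_div_iff₀ (by positivity), mul_comm]
    have : (M : ℝ) ≤ n := by exact_mod_cast not_lt.mp hn
    gcongr

theorem tendsto_lowPass {u : L2} (hu : u ∈ hardy) (he : HasEnergy u) :
    Tendsto (fun M => toL2 (lowPass M u)) atTop (𝓝 u) := by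
  rw [tendsto_iff_norm_sub_tendsto_zero]
  have h : Tendsto (fun M : ℕ => energy u / ((M : ℝ) + 1)) atTop (𝓝 0) :=
    tendsto_const_nhds.div_atTop (tendsto_natCast_atTop_atTop.atTop_add tendsto_const_nhds)
  have h2 : Tendsto (fun M : ℕ => ‖toL2 (lowPass M u) - u‖ ^ 2) atTop (𝓝 0) := by
    refine squeeze_zero (fun _ => by positivity) (fun M => ?_) h
    rw [norm_sub_rev]
    exact norm_sq_sub_lowPass_le hu he M
  have h3 := h2.sqrt
  simpa [Real.sqrt_sq] using h3

theorem eLpNorm_lowPass_four (M : ℕ) {u : L2} (he : HasEnergy u) :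
    eLpNorm (lowPass M u) 4 haarAddCircle ^ 2 ≤ ENNReal.ofReal (energy u) := by
  refine (eLpNorm_trigPoly_four _).trans (ENNReal.ofReal_le_ofReal ?_)
  refine (Finset.sum_le_sum fun k _ => ?_).trans
    (he.sum_le_tsum _ fun _ _ => by positivity)
  rw [coeff_truncPoly]
  split_ifs
  · exact le_rfl
  · simp; positivity

/-- Fatou along an a.e. convergent subsequence of the partial sums, whose `L⁴` norms are bounded
uniformly. -/
theorem eLpNorm_four_le {u : L2} (hu : u ∈ hardy) (he : HasEnergy u) :
    eLpNorm u 4 haarAddCircle ^ 2 ≤ ENNReal.ofReal (energy u) := by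
  obtain ⟨ns, -, hns⟩ := (tendstoInMeasure_of_tendsto_Lp (tendsto_lowPass hu he)).exists_seq_tendsto_ae
  have h := Lp.eLpNorm_lim_le_liminf_eLpNorm (p := 4) (fun n => Lp.aestronglyMeasurable _) _ hns
  have h2 : ∀ n, eLpNorm (toL2 (lowPass (ns n) u)) 4 haarAddCircle
      ≤ ENNReal.ofReal (energy u) ^ (1 / 2 : ℝ) := by
    intro n
    rw [eLpNorm_congr_ae (coe_toL2 _), ← ENNReal.rpow_le_rpow_iff (z := 2) (by norm_num), ← ENNReal.rpow_mul]
    norm_num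
    exact eLpNorm_lowPass_four _ he
  have h3 := h.trans (liminf_le_of_le (by isBoundedDefault) fun b hb => by
    obtain ⟨n, hn⟩ := hb.exists
    exact hn.trans (h2 n))
  calc eLpNorm u 4 haarAddCircle ^ 2 ≤ (ENNReal.ofReal (energy u) ^ (1 / 2 : ℝ)) ^ 2 := by gcongr
    _ = ENNReal.ofReal (energy u) := by
      rw [← ENNReal.rpow_natCast, ← ENNReal.rpow_mul]; norm_num

theorem memLp_four {u : L2} (hu : u ∈ hardy) (he : HasEnergy u) : MemLp u 4 haarAddCircle := by
  refine ⟨Lp.aestronglyMeasurable _, ?_⟩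
  by_contra h
  have h2 := eLpNorm_four_le hu he
  rw [not_lt_top_iff.mp h] at h2
  simp at h2

theorem norm_fourier_apply (n : ℤ) (x : Torus) : ‖(fourier n : C(Torus, ℂ)) x‖ = 1 := by
  rw [fourier_apply]; exact Circle.norm_coe _

/-- `H^{1/2}` just fails to embed in `L^∞`; Cauchy–Schwarz against the harmonic sum shows that the
failure is only `√(log M)` at frequencies below `M`. -/
theorem norm_lowPass_le (M : ℕ) {u : L2} (he : HasEnergy u) (x : Torus) :
    ‖lowPass M u x‖ ≤ Real.sqrt (1 + Real.log M) * Real.sqrt (energy u) := by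
  have h1 : ‖lowPass M u x‖ ≤ ∑ k ∈ Finset.range M, ‖coeffL k u‖ := by
    have : lowPass M u x = ∑ k ∈ Finset.range M, coeffL k u * fourier (k : ℤ) x := by
      simp only [lowPass, truncPoly, trigPoly, map_sum, Polynomial.aeval_monomial,
        fourier_one_pow, ← Algebra.smul_def, ContinuousMap.sum_apply]
      rfl
    rw [this]
    refine (norm_sum_le _ _).trans (Finset.sum_le_sum fun k _ => ?_)
    rw [norm_mul, norm_fourier_apply, mul_one]
  refine h1.trans ?_
  have h2 : ∀ k ∈ Finset.range M, ‖coeffL k u‖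
      = Real.sqrt (((k : ℝ) + 1)⁻¹) * Real.sqrt (((k : ℝ) + 1) * ‖coeffL k u‖ ^ 2) := by
    intro k _
    rw [← Real.sqrt_mul (by positivity), ← mul_assoc, inv_mul_cancel₀ (by positivity), one_mul,
      Real.sqrt_sq (norm_nonneg _)]
  rw [Finset.sum_congr rfl h2]
  refine (Real.sum_sqrt_mul_sqrt_le _ (fun _ => by positivity) (fun _ => by positivity)).trans ?_
  gcongr
  · have := harmonic_le_one_add_log M
    refine le_trans (le_of_eq ?_) this
    simp [harmonic]
  · exact he.sum_le_tsum _ fun _ _ => by positivity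

/-! ### Sobolev norms and the energy -/

theorem sobolevNorm_eq {s : ℝ} {u : L2}
    (h : Summable fun n : ℤ => (1 + (n : ℝ) ^ 2) ^ s * ‖coeffL n u‖ ^ 2) :
    sobolevNorm s u
      = ENNReal.ofReal (Real.sqrt (∑' n : ℤ, (1 + (n : ℝ) ^ 2) ^ s * ‖coeffL n u‖ ^ 2)) := by
  unfold sobolevNorm
  simp only [← coeffL_apply]
  rw [← ENNReal.ofReal_tsum_of_nonneg (fun _ => by positivity) h, Real.sqrt_eq_rpow,
    ENNReal.ofReal_rpow_of_nonneg (tsum_nonneg fun _ => by positivity) (by norm_num)]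

theorem summable_of_sobolevNorm_lt_top {s : ℝ} {u : L2} (h : sobolevNorm s u < ∞) :
    Summable fun n : ℤ => (1 + (n : ℝ) ^ 2) ^ s * ‖coeffL n u‖ ^ 2 := by
  unfold sobolevNorm at h
  simp only [← coeffL_apply] at h
  have h2 := (ENNReal.rpow_lt_top_iff_of_pos (by norm_num)).mp h
  refine (ENNReal.summable_toReal h2.ne).congr fun n => ?_
  rw [ENNReal.toReal_ofReal (by positivity)]

theorem le_sqrt_weight (n : ℕ) : (n : ℝ) + 1 ≤ 2 * (1 + ((n : ℤ) : ℝ) ^ 2) ^ (1 / 2 : ℝ) := by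
  rw [← Real.sqrt_eq_rpow]
  push_cast
  have h1 : (n : ℝ) ≤ Real.sqrt (1 + (n : ℝ) ^ 2) := Real.le_sqrt_of_sq_le (by linarith)
  have h2 : (1 : ℝ) ≤ Real.sqrt (1 + (n : ℝ) ^ 2) := Real.le_sqrt_of_sq_le (by nlinarith)
  linarith

theorem hasEnergy_of_sobolevNorm_lt_top {u : L2} (h : sobolevNorm (1 / 2) u < ∞) :
    HasEnergy u := by
  have h1 := (summable_of_sobolevNorm_lt_top h).comp_injective (i := ((↑) : ℕ → ℤ))
    Nat.cast_injective
  refine Summable.of_nonneg_of_le (fun _ => by positivity) (fun n => ?_) (h1.mul_left 2)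
  simp only [Function.comp]
  rw [← mul_assoc]
  gcongr
  exact le_sqrt_weight n

theorem energy_le_of_sobolevNorm {u : L2} {C : ℝ} (hC : 0 ≤ C)
    (h : sobolevNorm (1 / 2) u ≤ ENNReal.ofReal C) : energy u ≤ 2 * C ^ 2 := by
  have hlt : sobolevNorm (1 / 2) u < ∞ := h.trans_lt ENNReal.ofReal_lt_top
  have hs := summable_of_sobolevNorm_lt_top hlt
  rw [sobolevNorm_eq hs, ENNReal.ofReal_le_ofReal_iff hC, Real.sqrt_le_left hC] at h
  have h1 := hs.comp_injective (i := ((↑) : ℕ → ℤ)) Nat.cast_injective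
  have h2 : energy u ≤ ∑' n : ℕ, 2 * ((1 + ((n : ℤ) : ℝ) ^ 2) ^ (1 / 2 : ℝ) * ‖coeffL n u‖ ^ 2) := by
    refine Summable.tsum_le_tsum (fun n => ?_) (hasEnergy_of_sobolevNorm_lt_top hlt)
      (h1.mul_left 2)
    rw [← mul_assoc]
    gcongr
    exact le_sqrt_weight n
  rw [tsum_mul_left] at h2
  have h3 := _root_.tsum_comp_le_tsum_of_inj hs (fun _ => by positivity)
    (i := ((↑) : ℕ → ℤ)) Nat.cast_injective
  have h4 := h2.trans (mul_le_mul_of_nonneg_left h3 (by norm_num : (0 : ℝ) ≤ 2))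
  linarith

theorem hasEnergy_sub {u v : L2} (hu : HasEnergy u) (hv : HasEnergy v) :
    HasEnergy (u - v) ∧ energy (u - v) ≤ 2 * energy u + 2 * energy v := by
  have hs := (hu.mul_left 2).add (hv.mul_left 2)
  have hle : ∀ n : ℕ, ((n : ℝ) + 1) * ‖coeffL n (u - v)‖ ^ 2
      ≤ 2 * (((n : ℝ) + 1) * ‖coeffL n u‖ ^ 2) + 2 * (((n : ℝ) + 1) * ‖coeffL n v‖ ^ 2) := by
    intro n
    have h1 : ‖coeffL n (u - v)‖ ^ 2 ≤ 2 * ‖coeffL n u‖ ^ 2 + 2 * ‖coeffL n v‖ ^ 2 := by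
      rw [map_sub]
      have := norm_sub_le (coeffL n u) (coeffL n v)
      nlinarith [norm_nonneg (coeffL n u - coeffL n v), sq_nonneg (‖coeffL n u‖ - ‖coeffL n v‖)]
    have h2 : (0 : ℝ) ≤ (n : ℝ) + 1 := by positivity
    nlinarith [mul_le_mul_of_nonneg_left h1 h2]
  have hE : HasEnergy (u - v) := Summable.of_nonneg_of_le (fun _ => by positivity) hle hs
  refine ⟨hE, ?_⟩
  have := Summable.tsum_le_tsum hle hE hs
  rwa [(hu.mul_left 2).tsum_add (hv.mul_left 2), tsum_mul_left, tsum_mul_left] at this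

theorem hasEnergy_lowPass (M : ℕ) (u : L2) : HasEnergy (toL2 (lowPass M u)) := by
  apply summable_of_ne_finset_zero (s := Finset.range M)
  intro n hn
  rw [coeffL_lowPass, if_neg (by simpa using hn)]
  simp

theorem tendsto_energy_sub_lowPass {u : L2} (he : HasEnergy u) :
    Tendsto (fun M => energy (u - toL2 (lowPass M u))) atTop (𝓝 0) := by
  have h := tendsto_tsum_of_dominated_convergence (𝓕 := atTop)
    (f := fun M (n : ℕ) => ((n : ℝ) + 1) * ‖coeffL n (u - toL2 (lowPass M u))‖ ^ 2)
    (g := fun _ => (0 : ℝ)) he (fun n => ?_) (Eventually.of_forall fun M n => ?_)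
  · simpa [energy] using h
  · refine tendsto_const_nhds.congr' ?_
    filter_upwards [eventually_gt_atTop n] with M hM
    rw [map_sub, coeffL_lowPass, if_pos hM]
    simp
  · rw [Real.norm_of_nonneg (by positivity)]
    gcongr
    rw [map_sub, coeffL_lowPass]
    split_ifs <;> simp

/-! ### Pairing with a Szegő projection -/

instance holderTriple_four_four_two : ENNReal.HolderTriple 4 4 2 := ⟨by
  rw [← two_mul, show (4 : ℝ≥0∞) = 2 * 2 by norm_num, ENNReal.mul_inv (by norm_num) (by norm_num),
    ← mul_assoc, ENNReal.mul_inv_cancel (by norm_num) (by norm_num), one_mul]⟩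

theorem memLp_mul_mul {f g h : Torus → ℂ} (hf : MemLp f 4 haarAddCircle)
    (hg : MemLp g 4 haarAddCircle) (hh : MemLp h 2 haarAddCircle) :
    Integrable (fun x => f x * g x * h x) haarAddCircle := by
  have h1 : MemLp (f * g) 2 haarAddCircle := hg.mul hf
  have h2 : MemLp (f * g * h) 1 haarAddCircle := hh.mul h1
  exact memLp_one_iff_integrable.mp h2

theorem inner_toL2_fourier (k : ℤ) (v : L2) : inner ℂ (toL2 (fourier k)) v = coeffL k v := by
  have : toL2 (fourier k) = (fourierBasis k : L2) := by
    rw [coe_fourierBasis]; rfl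
  rw [this]; rfl

theorem inner_lowPass_szegoProj {f : Torus → ℂ} {N : L2} (hN : IsSzegoProj f N) (M : ℕ) (w : L2) :
    inner ℂ (toL2 (lowPass M w)) N
      = ∫ x, starRingEnd ℂ (lowPass M w x) * f x ∂haarAddCircle := by
  have e : lowPass M w = ∑ k ∈ Finset.range M, coeffL k w • (fourier (k : ℤ) : C(Torus, ℂ)) := by
    simp only [lowPass, truncPoly, trigPoly, map_sum, Polynomial.aeval_monomial,
        fourier_one_pow, ← Algebra.smul_def]
  have hint : ∀ k ∈ Finset.range M, Integrable (fun x => starRingEnd ℂ (coeffL k w) *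
      ((fourier (-k : ℤ) : C(Torus, ℂ)) x • f x)) haarAddCircle := by
    intro k _
    exact (hN.1.fourier_smul (-k)).const_mul _
  have e2 : (fun x => starRingEnd ℂ (lowPass M w x) * f x)
      = fun x => ∑ k ∈ Finset.range M, starRingEnd ℂ (coeffL k w) *
        ((fourier (-k : ℤ) : C(Torus, ℂ)) x • f x) := by
    ext x
    rw [e, ContinuousMap.sum_apply, map_sum, Finset.sum_mul]
    refine Finset.sum_congr rfl fun k _ => ?_
    rw [ContinuousMap.smul_apply, smul_eq_mul, map_mul, fourier_neg, smul_eq_mul, mul_assoc]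
  rw [e2, integral_finsetSum _ hint, e, map_sum, sum_inner]
  refine Finset.sum_congr rfl fun k _ => ?_
  rw [map_smul, inner_smul_left, inner_toL2_fourier, coeffL_apply k N, hN.2, if_pos (by positivity),
    integral_const_mul]
  rfl

/-- The cubic nonlinearity `|u|² u`. -/
def cubic (u : L2) : Torus → ℂ := fun x => (‖u x‖ : ℂ) ^ 2 * u x

theorem memLp_sq {u : L2} (hu : MemLp u 4 haarAddCircle) :
    MemLp (fun x => (‖u x‖ : ℂ) ^ 2) 2 haarAddCircle := by
  have h : MemLp (fun x => (‖u x‖ : ℂ)) 4 haarAddCircle := hu.norm.ofReal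
  have h2 : MemLp ((fun x => (‖u x‖ : ℂ)) * (fun x => (‖u x‖ : ℂ))) 2 haarAddCircle := h.mul h
  convert h2 using 1
  ext x
  simp [pow_two]

theorem memLp_conj {f : Torus → ℂ} {p : ℝ≥0∞} (hf : MemLp f p haarAddCircle) :
    MemLp (fun x => starRingEnd ℂ (f x)) p haarAddCircle := hf.star

theorem integrable_conj_mul_cubic {w : Torus → ℂ} {u : L2} (hw : MemLp w 4 haarAddCircle)
    (hu : MemLp u 4 haarAddCircle) :
    Integrable (fun x => starRingEnd ℂ (w x) * cubic u x) haarAddCircle := by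
  convert memLp_mul_mul (memLp_conj hw) hu (memLp_sq hu) using 2 with x
  simp only [cubic]
  ring

/-- `N` is known only through its Fourier coefficients, and `|u|²u` is merely in `L^{4/3}`. The
identity holds against trigonometric polynomials and passes to the limit because the partial sums of
`w` converge in `L⁴`. -/
theorem inner_szegoProj_cubic {u w N : L2} (hw : w ∈ hardy) (hwe : HasEnergy w)
    (hu : MemLp u 4 haarAddCircle) (hN : IsSzegoProj (cubic u) N) :
    inner ℂ w N = ∫ x, starRingEnd ℂ (w x) * cubic u x ∂haarAddCircle := by
  have h1 : Tendsto (fun M => inner ℂ (toL2 (lowPass M w)) N) atTop (𝓝 (inner ℂ w N)) :=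
    (tendsto_lowPass hw hwe).inner tendsto_const_nhds
  refine tendsto_nhds_unique h1 ?_
  simp only [inner_lowPass_szegoProj hN]
  have hlp : ∀ M, MemLp (lowPass M w) 4 haarAddCircle := fun M =>
    (memLp_congr_ae (coe_toL2 _)).mp (memLp_four (lowPass_mem_hardy M w) (hasEnergy_lowPass M w))
  refine tendsto_integral_of_L1' _ (integrable_conj_mul_cubic (memLp_four hw hwe) hu).aestronglyMeasurable
    (Eventually.of_forall fun M => integrable_conj_mul_cubic (hlp M) hu) ?_
  have hb : ∀ M, eLpNorm ((fun x => starRingEnd ℂ (lowPass M w x) * cubic u x)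
        - fun x => starRingEnd ℂ (w x) * cubic u x) 1 haarAddCircle
      ≤ ENNReal.ofReal (energy (w - toL2 (lowPass M w))) ^ (1 / 2 : ℝ)
        * (eLpNorm u 4 haarAddCircle * eLpNorm (fun x => (‖u x‖ : ℂ) ^ 2) 2 haarAddCircle) := by
    intro M
    set d : L2 := w - toL2 (lowPass M w) with hd
    have hdh : d ∈ hardy := hardy_sub hw (lowPass_mem_hardy M w)
    have hde : HasEnergy d := (hasEnergy_sub hwe (hasEnergy_lowPass M w)).1
    have hae : ((fun x => starRingEnd ℂ (lowPass M w x) * cubic u x)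
        - fun x => starRingEnd ℂ (w x) * cubic u x) =ᵐ[haarAddCircle]
        (((-(fun x => starRingEnd ℂ (d x))) • (u : Torus → ℂ)) • fun x => (‖u x‖ : ℂ) ^ 2) := by
      filter_upwards [Lp.coeFn_sub w (toL2 (lowPass M w)), coe_toL2 (lowPass M w)] with x h1 h2
      have h3 : d x = w x - lowPass M w x := by rw [hd, h1, Pi.sub_apply, h2]
      change _ - _ = (-(starRingEnd ℂ (d x)) * u x) * (‖u x‖ : ℂ) ^ 2
      simp only [cubic, h3, map_sub]
      ring
    have hdm : MemLp (-(fun x => starRingEnd ℂ (d x))) 4 haarAddCircle :=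
      (memLp_conj (memLp_four hdh hde)).neg
    have hdn : eLpNorm (-(fun x => starRingEnd ℂ (d x))) 4 haarAddCircle
        = eLpNorm d 4 haarAddCircle := by
      rw [eLpNorm_neg]
      exact eLpNorm_congr_norm_ae (Eventually.of_forall fun x => by simp)
    rw [eLpNorm_congr_ae hae]
    refine (eLpNorm_smul_le_mul_eLpNorm (p := 2) (q := 2) (memLp_sq hu).1
      (hdm.1.smul hu.1)).trans ?_
    rw [← mul_assoc]
    gcongr
    refine (eLpNorm_smul_le_mul_eLpNorm (p := 4) (q := 4) hu.1 hdm.1).trans ?_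
    gcongr
    rw [hdn, ← ENNReal.rpow_le_rpow_iff (z := 2) (by norm_num), ← ENNReal.rpow_mul]
    norm_num
    exact eLpNorm_four_le hdh hde
  have hlim : Tendsto (fun M => ENNReal.ofReal (energy (w - toL2 (lowPass M w))) ^ (1 / 2 : ℝ)
        * (eLpNorm u 4 haarAddCircle * eLpNorm (fun x => (‖u x‖ : ℂ) ^ 2) 2 haarAddCircle))
      atTop (𝓝 0) := by
    have h2 := ENNReal.tendsto_ofReal (tendsto_energy_sub_lowPass hwe)
    have h3 := h2.ennrpow_const (1 / 2 : ℝ)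
    have h4 := ENNReal.Tendsto.mul_const h3
      (b := eLpNorm u 4 haarAddCircle * eLpNorm (fun x => (‖u x‖ : ℂ) ^ 2) 2 haarAddCircle)
      (Or.inr (ENNReal.mul_ne_top hu.2.ne (memLp_sq hu).2.ne))
    simpa using h4
  exact tendsto_of_tendsto_of_tendsto_of_le_of_le tendsto_const_nhds hlim (fun _ => zero_le)
    hb

/-! ### Uniqueness -/

/-- With `w = u - v`, all real contributions drop out and the imaginary part is `Im((w̄v)²) + |w|²
Im(v w̄)`. Only `v` has to be bounded, and the quartic term in `w` disappears. -/
theorem im_conj_mul_cubic_sub_le {u v : ℂ} {V : ℝ} (hv : ‖v‖ ≤ V) :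
    |(starRingEnd ℂ (u - v) * ((‖u‖ : ℂ) ^ 2 * u) - starRingEnd ℂ (u - v) * ((‖v‖ : ℂ) ^ 2 * v)).im|
      ≤ V ^ 2 * ‖u - v‖ ^ 2 + V * ‖u - v‖ ^ 3 := by
  obtain ⟨w, rfl⟩ : ∃ w, u = v + w := ⟨u - v, by ring⟩
  rw [add_sub_cancel_left]
  have e : (starRingEnd ℂ w * ((‖v + w‖ : ℂ) ^ 2 * (v + w)) - starRingEnd ℂ w * ((‖v‖ : ℂ) ^ 2 * v)).im
      = ((starRingEnd ℂ w * v) ^ 2).im + ‖w‖ ^ 2 * (v * starRingEnd ℂ w).im := by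
    rw [← Complex.mul_conj', ← Complex.mul_conj', Complex.sq_norm, Complex.normSq_apply]
    simp only [Complex.sub_im, Complex.mul_im, Complex.mul_re, Complex.conj_re, Complex.conj_im,
      Complex.add_re, Complex.add_im, pow_two, map_add]
    ring
  rw [e]
  have hV : 0 ≤ V := (norm_nonneg v).trans hv
  have h1 : |((starRingEnd ℂ w * v) ^ 2).im| ≤ V ^ 2 * ‖w‖ ^ 2 := by
    refine (Complex.abs_im_le_norm _).trans ?_
    rw [norm_pow, norm_mul, RCLike.norm_conj, mul_pow, mul_comm]
    gcongr
  have h2 : |(v * starRingEnd ℂ w).im| ≤ V * ‖w‖ := by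
    refine (Complex.abs_im_le_norm _).trans ?_
    rw [norm_mul, RCLike.norm_conj]
    gcongr
  calc _ ≤ |((starRingEnd ℂ w * v) ^ 2).im| + |‖w‖ ^ 2 * (v * starRingEnd ℂ w).im| := abs_add_le _ _
    _ ≤ V ^ 2 * ‖w‖ ^ 2 + ‖w‖ ^ 2 * (V * ‖w‖) := by
      rw [abs_mul, abs_of_nonneg (sq_nonneg ‖w‖)]
      gcongr
    _ = _ := by ring

theorem integral_norm_sq (u : L2) : ∫ x, ‖u x‖ ^ 2 ∂haarAddCircle = ‖u‖ ^ 2 := by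
  refine (hasSum_sq_fourierCoeff u).unique ?_
  simpa only [coeffL_apply] using hasSum_norm_sq_coeffL u

theorem integrable_norm_pow {u : L2} (hu : MemLp u 4 haarAddCircle) (k : ℕ) (hk : k ≤ 4) :
    Integrable (fun x => ‖u x‖ ^ k) haarAddCircle := by
  have : MemLp u (k : ℝ≥0∞) haarAddCircle := hu.mono_exponent (by exact_mod_cast hk)
  exact this.integrable_norm_pow'

theorem integral_norm_sq_mul_le {w d : L2} (hw : w ∈ hardy) (he : HasEnergy w) :
    Integrable (fun x => ‖w x‖ ^ 2 * ‖d x‖) haarAddCircle ∧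
    ∫ x, ‖w x‖ ^ 2 * ‖d x‖ ∂haarAddCircle ≤ energy w * ‖d‖ := by
  have hw4 := memLp_four hw he
  have h2 : MemLp ((fun x => (‖w x‖ : ℂ) ^ 2) • (d : Torus → ℂ)) 1 haarAddCircle :=
    (Lp.memLp d).smul (memLp_sq hw4)
  have hn : ∀ x, ‖((fun x => (‖w x‖ : ℂ) ^ 2) • (d : Torus → ℂ)) x‖ = ‖w x‖ ^ 2 * ‖d x‖ := by
    intro x
    simp
  have hint := (memLp_one_iff_integrable.mp h2).norm
  simp only [hn] at hint
  refine ⟨hint, ?_⟩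
  have h3 : ∫ x, ‖w x‖ ^ 2 * ‖d x‖ ∂haarAddCircle
      = (eLpNorm ((fun x => (‖w x‖ : ℂ) ^ 2) • (d : Torus → ℂ)) 1 haarAddCircle).toReal := by
    rw [eLpNorm_one_eq_lintegral_enorm, ← integral_norm_eq_lintegral_enorm h2.1]
    simp only [hn]
  rw [h3]
  refine ENNReal.toReal_le_of_le_ofReal (by have := energy_nonneg w; positivity) ?_
  refine (eLpNorm_smul_le_mul_eLpNorm (p := 2) (q := 2) (Lp.memLp d).1 (memLp_sq hw4).1).trans ?_
  rw [ENNReal.ofReal_mul (energy_nonneg w), ofReal_norm, Lp.enorm_def]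
  gcongr
  refine le_trans (le_of_eq ?_) (eLpNorm_four_le hw he)
  rw [eLpNorm_four_sq]
  exact eLpNorm_congr_norm_ae (Eventually.of_forall fun x => by simp)

/-- One factor `|w|` is split at frequency `M`: the low part is bounded in sup norm, the tail is
small in `L²` and is paired with `|w|²`, which is in `L²` by the `L⁴` embedding. -/
theorem integral_norm_cube_le {w : L2} (hw : w ∈ hardy) (he : HasEnergy w) (M : ℕ) :
    ∫ x, ‖w x‖ ^ 3 ∂haarAddCircle ≤ Real.sqrt (1 + Real.log M) * Real.sqrt (energy w) * ‖w‖ ^ 2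
      + energy w * Real.sqrt (energy w / (M + 1)) := by
  set d : L2 := w - toL2 (lowPass M w) with hd
  set K := Real.sqrt (1 + Real.log M) * Real.sqrt (energy w) with hK
  have hdn : ‖d‖ ≤ Real.sqrt (energy w / (M + 1)) :=
    Real.le_sqrt_of_sq_le (norm_sq_sub_lowPass_le hw he M)
  have hw4 := memLp_four hw he
  obtain ⟨hi, hle⟩ := integral_norm_sq_mul_le (d := d) hw he
  have hi2 : Integrable (fun x => K * ‖w x‖ ^ 2) haarAddCircle :=
    (integrable_norm_pow hw4 2 (by norm_num)).const_mul _
  calc ∫ x, ‖w x‖ ^ 3 ∂haarAddCircle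
      ≤ ∫ x, (K * ‖w x‖ ^ 2 + ‖w x‖ ^ 2 * ‖d x‖) ∂haarAddCircle := by
        refine integral_mono_ae (integrable_norm_pow hw4 3 (by norm_num)) (hi2.add hi) ?_
        filter_upwards [Lp.coeFn_sub w (toL2 (lowPass M w)), coe_toL2 (lowPass M w)] with x h1 h2
        have h3 : w x = lowPass M w x + d x := by rw [hd, h1, Pi.sub_apply, h2]; ring
        have h4 : ‖w x‖ ≤ K + ‖d x‖ := by
          conv_lhs => rw [h3]
          exact (norm_add_le _ _).trans (by gcongr; exact norm_lowPass_le M he x)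
        calc ‖w x‖ ^ 3 = ‖w x‖ ^ 2 * ‖w x‖ := by ring
          _ ≤ ‖w x‖ ^ 2 * (K + ‖d x‖) := by gcongr
          _ = _ := by ring
    _ = K * ‖w‖ ^ 2 + ∫ x, ‖w x‖ ^ 2 * ‖d x‖ ∂haarAddCircle := by
        rw [integral_add hi2 hi, integral_const_mul, integral_norm_sq]
    _ ≤ _ := by
        gcongr
        exact hle.trans (by gcongr; exact energy_nonneg w)

theorem coe_one : (one : L2) = toL2 1 := by
  apply Lp.ext
  filter_upwards [coe_toL2 1, Lp.coeFn_const 2 haarAddCircle (1 : ℂ)] with x h1 h2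
  rw [h1, one, h2]; rfl

theorem mean_eq (u : L2) : mean u = coeffL 0 u := by
  rw [coeffL_apply]; simp [mean, fourierCoeff]

theorem inner_one (u : L2) : inner ℂ u one = starRingEnd ℂ (coeffL 0 u) := by
  rw [coe_one, ← inner_conj_symm, show (1 : C(Torus, ℂ)) = fourier 0 by ext; simp,
    inner_toL2_fourier]

theorem hasDerivAt_norm_sq {w : ℝ → L2} {dw : L2} {t : ℝ} (h : HasDerivAt w dw t) :
    HasDerivAt (fun s => ‖w s‖ ^ 2) (2 * (inner ℂ (w t) (Complex.I • dw)).im) t := by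
  have h1 := h.inner ℂ h
  have h2 := Complex.reCLM.hasFDerivAt.comp_hasDerivAt t h1
  have e1 : (fun s => ‖w s‖ ^ 2) = Complex.reCLM ∘ fun s => inner ℂ (w s) (w s) := by
    ext s
    rw [Function.comp, inner_self_eq_norm_sq_to_K]
    change _ = (((‖w s‖ : ℝ) : ℂ) ^ 2).re
    rw [← Complex.ofReal_pow, Complex.ofReal_re]
  have e2 : 2 * (inner ℂ (w t) (Complex.I • dw)).im
      = Complex.reCLM (inner ℂ (w t) dw + inner ℂ dw (w t)) := by
    rw [inner_smul_right, ← inner_conj_symm dw (w t), Complex.reCLM_apply, Complex.add_re,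
      Complex.conj_re, Complex.I_mul_im]
    ring
  rw [e1, e2]
  exact h2

/-- The term `α(w | 1)` contributes the real number `α|ŵ(0)|²` and vanishes in the imaginary part.
The derivative is chosen before `M`, so the estimate can be used for all `M` at once. -/
theorem abs_deriv_norm_sq_le {α V A : ℝ} {u v : ℝ → L2} {u₀ v₀ : L2}
    (hu : IsGlobalSolution α u₀ u) (hv : IsGlobalSolution α v₀ v) {t : ℝ}
    (hV : ∀ᵐ x ∂haarAddCircle, ‖v t x‖ ≤ V) (hA : energy (u t - v t) ≤ A) :
    ∃ y' : ℝ, HasDerivAt (fun s => ‖u s - v s‖ ^ 2) y' t ∧ ∀ M : ℕ,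
      |y'| ≤ 2 * (V ^ 2 + V * (Real.sqrt (1 + Real.log M) * Real.sqrt A)) * ‖u t - v t‖ ^ 2
        + 2 * V * (A * Real.sqrt (A / (M + 1))) := by
  obtain ⟨Nu, du, hNu, hdu, hequ⟩ := hu.eqn t
  obtain ⟨Nv, dv, hNv, hdv, heqv⟩ := hv.eqn t
  have hue := hasEnergy_of_sobolevNorm_lt_top (hu.mem t).2
  have hve := hasEnergy_of_sobolevNorm_lt_top (hv.mem t).2
  refine ⟨_, hasDerivAt_norm_sq (hdu.sub hdv), fun M => ?_⟩
  have hV0 : 0 ≤ V := by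
    obtain ⟨x, hx⟩ := hV.exists
    exact (norm_nonneg _).trans hx
  set w : L2 := u t - v t with hw
  have hwh : w ∈ hardy := hardy_sub (hu.mem t).1 (hv.mem t).1
  have hwe : HasEnergy w := (hasEnergy_sub hue hve).1
  have hw4 := memLp_four hwh hwe
  have hu4 := memLp_four (hu.mem t).1 hue
  have hv4 := memLp_four (hv.mem t).1 hve
  have hiu := integrable_conj_mul_cubic hw4 hu4
  have hiv := integrable_conj_mul_cubic hw4 hv4
  have e1 : Complex.I • (du - dv) = Nu - Nv + ((α : ℂ) * coeffL 0 w) • one := by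
    rw [smul_sub, hequ, heqv, mean_eq, mean_eq, hw, map_sub, mul_sub, sub_smul]
    abel
  have e2 : (inner ℂ w (Complex.I • (du - dv))).im
      = ∫ x, (starRingEnd ℂ (w x) * cubic (u t) x - starRingEnd ℂ (w x) * cubic (v t) x).im
        ∂haarAddCircle := by
    rw [e1, inner_add_right, inner_sub_right, inner_szegoProj_cubic hwh hwe hu4 hNu,
      inner_szegoProj_cubic hwh hwe hv4 hNv, ← integral_sub hiu hiv, inner_smul_right, inner_one,
      mul_assoc, Complex.mul_conj', Complex.add_im]
    have : ((α : ℂ) * (‖coeffL 0 w‖ : ℂ) ^ 2).im = 0 := by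
      rw [← Complex.ofReal_pow, ← Complex.ofReal_mul, Complex.ofReal_im]
    rw [this, add_zero]
    exact (integral_im (hiu.sub hiv)).symm
  have hA0 : 0 ≤ A := (energy_nonneg w).trans hA
  have i2 := (integrable_norm_pow hw4 2 (by norm_num)).const_mul (V ^ 2)
  have i3 := (integrable_norm_pow hw4 3 (by norm_num)).const_mul V
  have e3 : |(inner ℂ w (Complex.I • (du - dv))).im|
      ≤ V ^ 2 * ‖w‖ ^ 2 + V * ∫ x, ‖w x‖ ^ 3 ∂haarAddCircle := by
    rw [e2, ← integral_norm_sq, ← integral_const_mul, ← integral_const_mul, ← integral_add i2 i3]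
    refine abs_integral_le_integral_abs.trans ?_
    refine integral_mono_ae (hiu.sub hiv).im.abs (i2.add i3) ?_
    filter_upwards [hV, Lp.coeFn_sub (u t) (v t)] with x h1 h2
    have h3 : w x = u t x - v t x := by rw [hw, h2, Pi.sub_apply]
    simp only [cubic, h3]
    exact im_conj_mul_cubic_sub_le h1
  have e4 := integral_norm_cube_le hwh hwe M
  have e5 : ∫ x, ‖w x‖ ^ 3 ∂haarAddCircle ≤ Real.sqrt (1 + Real.log M) * Real.sqrt A * ‖w‖ ^ 2
      + A * Real.sqrt (A / (M + 1)) := e4.trans (by gcongr)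
  rw [abs_mul, abs_two]
  have := mul_le_mul_of_nonneg_left e5 hV0
  change 2 * |(inner ℂ w (Complex.I • (du - dv))).im| ≤ _
  linarith

theorem gronwallBound_zero_le {K ε x : ℝ} (hK : 1 ≤ K) (hε : 0 ≤ ε) :
    gronwallBound 0 K ε x ≤ ε * Real.exp (K * x) := by
  rw [gronwallBound_of_K_ne_0 (by positivity)]
  have h1 : ε / K ≤ ε := div_le_self hε hK
  have h2 : ε / K * (Real.exp (K * x) - 1) ≤ ε / K * Real.exp (K * x) := by
    gcongr; linarith
  simp only [zero_mul, zero_add]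
  exact h2.trans (by gcongr)

/-- From `bT·s ≤ (bT)² + s²/4` with `s² = 1 + log M`, the exponential costs at most `M^{1/4}` up to
a constant, against the gain `M^{-1/2}`. -/
theorem tendsto_exp_sqrt_log (a b c T : ℝ) (hc : 0 ≤ c) :
    Tendsto (fun M : ℕ => c / Real.sqrt (M + 1)
      * Real.exp ((a + b * Real.sqrt (1 + Real.log M)) * T)) atTop (𝓝 0) := by
  have hlim : Tendsto (fun M : ℕ => c * Real.exp (a * T + (b * T) ^ 2 + 1 / 4)
      * Real.exp (-(1 / 4 * Real.log M))) atTop (𝓝 0) := by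
    have h1 : Tendsto (fun M : ℕ => 1 / 4 * Real.log M) atTop atTop :=
      (Real.tendsto_log_atTop.comp tendsto_natCast_atTop_atTop).const_mul_atTop (by norm_num)
    have h2 := (Real.tendsto_exp_neg_atTop_nhds_zero.comp h1).const_mul
      (c * Real.exp (a * T + (b * T) ^ 2 + 1 / 4))
    simpa using h2
  refine squeeze_zero' (Eventually.of_forall fun _ => by positivity) ?_ hlim
  filter_upwards [eventually_ge_atTop 1] with M hM
  have hM' : (1 : ℝ) ≤ M := by exact_mod_cast hM
  have hlog : 0 ≤ Real.log M := Real.log_nonneg hM'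
  have h1 : c / Real.sqrt (M + 1) ≤ c * Real.exp (-(1 / 2 * Real.log M)) := by
    rw [Real.exp_neg, ← div_eq_mul_inv]
    gcongr
    rw [Real.sqrt_eq_rpow, mul_comm, ← Real.rpow_def_of_pos (by positivity)]
    gcongr
    linarith
  calc _ ≤ c * Real.exp (-(1 / 2 * Real.log M))
        * Real.exp ((a + b * Real.sqrt (1 + Real.log M)) * T) := by gcongr
    _ = c * Real.exp (-(1 / 2 * Real.log M) + (a + b * Real.sqrt (1 + Real.log M)) * T) := by
        rw [mul_assoc, ← Real.exp_add]
    _ ≤ c * Real.exp ((a * T + (b * T) ^ 2 + 1 / 4) + -(1 / 4 * Real.log M)) := by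
        refine mul_le_mul_of_nonneg_left (Real.exp_le_exp.mpr ?_) hc
        have h2 := Real.sq_sqrt (show 0 ≤ 1 + Real.log M by positivity)
        nlinarith [sq_nonneg (b * T - Real.sqrt (1 + Real.log M) / 2)]
    _ = _ := by rw [Real.exp_add, mul_assoc]

/-- Grönwall is applied for each fixed `M`, and `M → ∞` afterwards; because the growth rate is only
`√(log M)`, no restriction on `T` is needed. -/
theorem eq_zero_of_log_gronwall_right {y y' : ℝ → ℝ} {a b c T : ℝ} (ha : 1 ≤ a) (hb : 0 ≤ b)
    (hc : 0 ≤ c) (hy0 : y 0 = 0) (hd : ∀ t ∈ Set.Icc 0 T, HasDerivAt y (y' t) t)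
    (hle : ∀ t ∈ Set.Icc 0 T, ∀ M : ℕ,
      |y' t| ≤ (a + b * Real.sqrt (1 + Real.log M)) * |y t| + c / Real.sqrt (M + 1)) :
    ∀ t ∈ Set.Icc 0 T, y t = 0 := by
  intro t ht
  have hM : ∀ M : ℕ, |y t| ≤ c / Real.sqrt (M + 1)
      * Real.exp ((a + b * Real.sqrt (1 + Real.log M)) * t) := by
    intro M
    have h := norm_le_gronwallBound_of_norm_deriv_right_le (f := y) (f' := y') (δ := 0)
      (K := a + b * Real.sqrt (1 + Real.log M)) (ε := c / Real.sqrt (M + 1)) (a := 0) (b := T)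
      (fun s hs => (hd s hs).continuousAt.continuousWithinAt)
      (fun s hs => (hd s ⟨hs.1, hs.2.le⟩).hasDerivWithinAt) (by simp [hy0])
      (fun s hs => hle s ⟨hs.1, hs.2.le⟩ M) t ht
    rw [sub_zero] at h
    refine h.trans (gronwallBound_zero_le ?_ (by positivity))
    have : 0 ≤ b * Real.sqrt (1 + Real.log M) := by positivity
    linarith
  have h0 := ge_of_tendsto (tendsto_exp_sqrt_log a b c t hc) (Eventually.of_forall hM)
  exact abs_eq_zero.mp (le_antisymm h0 (abs_nonneg _))

theorem IsGlobalSolution.bddAbove_energy {α : ℝ} {u₀ : L2} {u : ℝ → L2}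
    (hu : IsGlobalSolution α u₀ u) (T : ℝ) :
    ∃ C, ∀ t ∈ Set.Icc (-T) T, energy (u t) ≤ C := by
  refine (isCompact_Icc (a := -T) (b := T)).induction_on (p := fun s => ∃ C, ∀ t ∈ s, energy (u t) ≤ C)
    ⟨0, by simp⟩ (fun s s' hss ⟨C, hC⟩ => ⟨C, fun t ht => hC t (hss ht)⟩)
    (fun s s' ⟨C, hC⟩ ⟨C', hC'⟩ => ⟨max C C', fun t ht => ?_⟩) (fun t₀ _ => ?_)
  · rcases ht with ht | ht
    · exact (hC t ht).trans (le_max_left _ _)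
    · exact (hC' t ht).trans (le_max_right _ _)
  · have h1 : ∀ᶠ t in 𝓝 t₀, sobolevNorm (1 / 2) (u t - u t₀) < 1 :=
      (hu.cont t₀).eventually_lt_const (by norm_num)
    refine ⟨_, mem_nhdsWithin_of_mem_nhds h1, 2 * 2 + 2 * energy (u t₀), fun t ht => ?_⟩
    have h2 : sobolevNorm (1 / 2) (u t - u t₀) < 1 := ht
    have h3 := energy_le_of_sobolevNorm (C := 1) (by norm_num) (by simpa using h2.le)
    have h0 := hasEnergy_of_sobolevNorm_lt_top (hu.mem t₀).2
    have hd := hasEnergy_of_sobolevNorm_lt_top (h2.trans ENNReal.one_lt_top)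
    -- The second argument is `-u t₀`, so the difference is `u t` and the bound for differences
    -- serves as one for sums.
    have h4 := (hasEnergy_sub (u := u t - u t₀) (v := u t₀ - u t₀ - u t₀) hd
      (by simpa [HasEnergy] using h0)).2
    have h5 : energy (u t₀ - u t₀ - u t₀) = energy (u t₀) := by simp [energy]
    rw [h5, show u t - u t₀ - (u t₀ - u t₀ - u t₀) = u t by abel] at h4
    linarith

theorem IsGlobalSolution.unique {α : ℝ} {u₀ : L2} {u v : ℝ → L2} {V : ℝ}
    (hu : IsGlobalSolution α u₀ u) (hv : IsGlobalSolution α u₀ v)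
    (hV : ∀ t, ∀ᵐ x ∂haarAddCircle, ‖v t x‖ ≤ V) : u = v := by
  have hV0 : 0 ≤ V := by
    obtain ⟨x, hx⟩ := (hV 0).exists
    exact (norm_nonneg _).trans hx
  ext1 t
  obtain ⟨Cu, hCu⟩ := hu.bddAbove_energy |t|
  obtain ⟨Cv, hCv⟩ := hv.bddAbove_energy |t|
  set A := 2 * Cu + 2 * Cv with hA
  have hAe : ∀ s ∈ Set.Icc (-|t|) |t|, energy (u s - v s) ≤ A := by
    intro s hs
    have := (hasEnergy_sub (hasEnergy_of_sobolevNorm_lt_top (hu.mem s).2)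
      (hasEnergy_of_sobolevNorm_lt_top (hv.mem s).2)).2
    linarith [hCu s hs, hCv s hs]
  have hA0 : 0 ≤ A := (energy_nonneg _).trans (hAe 0 (by simp))
  set y : ℝ → ℝ := fun s => ‖u s - v s‖ ^ 2 with hy
  have hy0 : y 0 = 0 := by simp [hy, hu.init, hv.init]
  have hd : ∀ s ∈ Set.Icc (-|t|) |t|, ∃ y' : ℝ, HasDerivAt y y' s ∧ ∀ M : ℕ,
      |y'| ≤ ((2 * V ^ 2 + 1) + (2 * V * Real.sqrt A) * Real.sqrt (1 + Real.log M)) * |y s|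
        + (2 * V * A * Real.sqrt A) / Real.sqrt (M + 1) := by
    intro s hs
    obtain ⟨y', h1, h2⟩ := abs_deriv_norm_sq_le hu hv (hV s) (hAe s hs)
    refine ⟨y', h1, fun M => (h2 M).trans ?_⟩
    have h3 : |y s| = ‖u s - v s‖ ^ 2 := abs_of_nonneg (by positivity)
    rw [h3, Real.sqrt_div hA0]
    have h4 : 2 * V * (A * (Real.sqrt A / Real.sqrt (M + 1)))
        = (2 * V * A * Real.sqrt A) / Real.sqrt (M + 1) := by ring
    rw [h4]
    gcongr
    linarith
  choose! y' hy' hle using hd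
  have hyt : y t = 0 := by
    rcases le_total 0 t with h | h
    · rw [abs_of_nonneg h] at hy' hle
      exact eq_zero_of_log_gronwall_right (y' := y') (T := t) (by nlinarith [sq_nonneg V])
        (by positivity) (by positivity) hy0 (fun s hs => hy' s ⟨by linarith [hs.1], hs.2⟩)
        (fun s hs => hle s ⟨by linarith [hs.1], hs.2⟩) t ⟨h, le_rfl⟩
    -- Negative times follow by applying the forward statement to `s ↦ y (-s)`.
    · rw [abs_of_nonpos h] at hy' hle
      have hs' : ∀ s ∈ Set.Icc 0 (-t), -s ∈ Set.Icc (- -t) (-t) := fun s hs =>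
        ⟨by linarith [hs.2], by linarith [hs.1, hs.2]⟩
      have := eq_zero_of_log_gronwall_right (y := fun s => y (-s)) (y' := fun s => -(y' (-s)))
        (T := -t) (a := 2 * V ^ 2 + 1) (b := 2 * V * Real.sqrt A) (c := 2 * V * A * Real.sqrt A)
        (by nlinarith [sq_nonneg V])
        (by positivity) (by positivity) (by simpa using hy0)
        (fun s hs => by
          have h1 := (hy' (-s) (hs' s hs)).comp s (hasDerivAt_neg s)
          rwa [mul_neg_one] at h1)
        (fun s hs M => by
          rw [abs_neg]
          exact hle (-s) (hs' s hs) M) (-t) ⟨by linarith, le_rfl⟩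
      simpa using this
  have : ‖u t - v t‖ = 0 := by simpa [hy] using hyt
  exact sub_eq_zero.mp (norm_eq_zero.mp this)

/-! ### The reduced system of ordinary differential equations -/

/-- Boundedness of `f` lets Picard–Lindelöf run on each interval `[-(n+1), n+1]` in a ball of radius
proportional to `n + 1`; uniqueness glues the pieces. -/
theorem exists_global_solution_of_lipschitz {E : Type*} [NormedAddCommGroup E] [NormedSpace ℝ E]
    [CompleteSpace E] {f : E → E} {K : NNReal} {L : ℝ} (hf : LipschitzWith K f)
    (hb : ∀ x, ‖f x‖ ≤ L) (x₀ : E) :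
    ∃ γ : ℝ → E, γ 0 = x₀ ∧ ∀ t, HasDerivAt γ (f (γ t)) t := by
  have hL : 0 ≤ L := (norm_nonneg _).trans (hb x₀)
  have hloc : ∀ n : ℕ, ∃ γ : ℝ → E, γ 0 = x₀ ∧
      ∀ t ∈ Set.Ioo (-((n : ℝ) + 1)) (n + 1), HasDerivAt γ (f (γ t)) t := by
    intro n
    have hn : (0 : ℝ) ≤ n + 1 := by positivity
    have h : IsPicardLindelof (fun _ => f) (tmin := -((n : ℝ) + 1)) (tmax := n + 1)
        ⟨0, neg_nonpos.mpr hn, hn⟩ x₀ (L.toNNReal * (n + 1)) 0 L.toNNReal K :=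
      { lipschitzOnWith := fun _ _ => hf.lipschitzOnWith
        continuousOn := fun _ _ => continuousOn_const
        norm_le := fun _ _ x _ => by rw [Real.coe_toNNReal L hL]; exact hb x
        mul_max_le := by simp }
    obtain ⟨γ, h0, hγ⟩ := h.exists_eq_forall_mem_Icc_hasDerivWithinAt₀
    exact ⟨γ, h0, fun t ht => (hγ t (Set.Ioo_subset_Icc_self ht)).hasDerivAt
      (Icc_mem_nhds ht.1 ht.2)⟩
  choose γ h0 hγ using hloc
  have hsub : ∀ m n : ℕ, m ≤ n →
      Set.Ioo (-((m : ℝ) + 1)) (m + 1) ⊆ Set.Ioo (-((n : ℝ) + 1)) (n + 1) := by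
    intro m n h
    have : (m : ℝ) ≤ n := by exact_mod_cast h
    exact Set.Ioo_subset_Ioo (by linarith) (by linarith)
  have heq' : ∀ m n : ℕ, m ≤ n → ∀ t ∈ Set.Ioo (-((m : ℝ) + 1)) (m + 1), γ m t = γ n t := by
    intro m n h
    have hm : (0 : ℝ) < m + 1 := by positivity
    exact ODE_solution_unique_of_mem_Ioo (v := fun _ => f) (s := fun _ => Set.univ) (K := K)
      (t₀ := 0) (fun _ _ => hf.lipschitzOnWith) ⟨by linarith, hm⟩
      (fun t ht => ⟨hγ m t ht, Set.mem_univ _⟩)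
      (fun t ht => ⟨hγ n t (hsub m n h ht), Set.mem_univ _⟩) (by rw [h0, h0])
  have heq : ∀ m n : ℕ, ∀ t ∈ Set.Ioo (-((m : ℝ) + 1)) (m + 1),
      t ∈ Set.Ioo (-((n : ℝ) + 1)) (n + 1) → γ m t = γ n t := by
    intro m n t hm hn
    rcases le_total m n with h | h
    · exact heq' m n h t hm
    · exact (heq' n m h t hn).symm
  have hmem : ∀ t : ℝ, t ∈ Set.Ioo (-((⌈|t|⌉₊ : ℝ) + 1)) (⌈|t|⌉₊ + 1) := fun t => by
    have h1 := Nat.le_ceil |t|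
    have h2 := abs_le.mp h1
    exact ⟨by linarith [h2.1], by linarith [h2.2]⟩
  refine ⟨fun t => γ ⌈|t|⌉₊ t, h0 _, fun t => ?_⟩
  refine (hγ _ t (hmem t)).congr_of_eventuallyEq ?_
  filter_upwards [Ioo_mem_nhds (hmem t).1 (hmem t).2] with s hs
  exact heq _ _ s (hmem s) hs

/-- A smooth cutoff makes the field bounded and Lipschitz, hence the flow global. The cutoff only
rescales the speed, so it preserves first integrals of `F`; once these confine the orbit to the ball
of radius `R`, it equals `1` and no continuation argument is needed. -/
theorem exists_global_cutoff_solution {E : Type*} [NormedAddCommGroup E] [NormedSpace ℝ E]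
    [FiniteDimensional ℝ E] {F : E → E} (hF : ContDiff ℝ 1 F) {R : ℝ} (hR : 0 < R) (x₀ : E) :
    ∃ (γ : ℝ → E) (k : E → ℝ), γ 0 = x₀ ∧ (∀ t, HasDerivAt γ (k (γ t) • F (γ t)) t) ∧
      ∀ x, ‖x‖ ≤ R → k x = 1 := by
  have : CompleteSpace E := FiniteDimensional.complete ℝ E
  let χ : ContDiffBump (0 : E) := ⟨R, R + 1, hR, by linarith⟩
  have hc : HasCompactSupport fun x => χ x • F x := χ.hasCompactSupport.smul_right
  have hd : ContDiff ℝ 1 fun x => χ x • F x := χ.contDiff.smul hF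
  obtain ⟨K, hK⟩ := hd.lipschitzWith_of_hasCompactSupport hc one_ne_zero
  obtain ⟨L, hL⟩ := hc.exists_bound_of_continuous hd.continuous
  obtain ⟨γ, h0, hγ⟩ := exists_global_solution_of_lipschitz hK hL x₀
  exact ⟨γ, χ, h0, hγ, fun x hx => χ.one_of_mem_closedBall (by simpa using hx)⟩

/-- The vector field of the reduced system for `(b, c, p)`, with `l` the value of
`|c| / (1 - |p|²)`. -/
def field (α l : ℝ) (y : ℂ × ℂ × ℂ) : ℂ × ℂ × ℂ :=
  let b := y.1
  let c := y.2.1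
  let p := y.2.2
  let b' := starRingEnd ℂ b
  let p' := starRingEnd ℂ p
  (-Complex.I * (b * b' * b + 2 * l ^ 2 * (1 - p * p') * b + l ^ 2 * c * p' + α * b),
    -Complex.I * (2 * b * b' * c + l ^ 2 * c + 2 * l ^ 2 * (1 - p * p') * b * p),
    -Complex.I * (b' * c + l ^ 2 * (1 - p * p') * p))

theorem contDiff_conj {E : Type*} [NormedAddCommGroup E] [NormedSpace ℝ E] {f : E → ℂ}
    (hf : ContDiff ℝ 1 f) : ContDiff ℝ 1 fun x => starRingEnd ℂ (f x) :=
  Complex.conjCLE.contDiff.comp hf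

theorem contDiff_field (α l : ℝ) : ContDiff ℝ 1 (field α l) := by
  have hb : ContDiff ℝ 1 fun y : ℂ × ℂ × ℂ => y.1 := contDiff_fst
  have hc : ContDiff ℝ 1 fun y : ℂ × ℂ × ℂ => y.2.1 := contDiff_fst.comp contDiff_snd
  have hp : ContDiff ℝ 1 fun y : ℂ × ℂ × ℂ => y.2.2 := contDiff_snd.comp contDiff_snd
  have hb' := contDiff_conj hb
  have hp' := contDiff_conj hp
  unfold field
  dsimp only
  fun_prop

theorem HasDerivAt.conj_complex {f : ℝ → ℂ} {f' : ℂ} {t : ℝ} (h : HasDerivAt f f' t) :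
    HasDerivAt (fun s => starRingEnd ℂ (f s)) (starRingEnd ℂ f') t :=
  Complex.conjCLE.hasFDerivAt.comp_hasDerivAt t h

theorem eq_of_hasDerivAt_zero {f : ℝ → ℂ} (h : ∀ t, HasDerivAt f 0 t) (t : ℝ) : f t = f 0 :=
  is_const_of_deriv_eq_zero (fun t => (h t).differentiableAt) (fun t => (h t).deriv) t 0

/-- Three conserved quantities of the reduced system. -/
def invariants (α l : ℝ) (y : ℂ × ℂ × ℂ) : ℝ × ℝ × ℝ :=
  (‖y.2.1‖ ^ 2 - l ^ 2 * (1 - ‖y.2.2‖ ^ 2) ^ 2,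
    ‖y.1‖ ^ 2 + l ^ 2 * (1 - ‖y.2.2‖ ^ 2),
    (1 - ‖y.2.2‖ ^ 2) * (-2 * α + 2 * (‖y.1‖ ^ 2 + l ^ 2 * (1 - ‖y.2.2‖ ^ 2)) + 2 * l ^ 2
          - 4 * l ^ 2 * (1 - ‖y.2.2‖ ^ 2)) + 4 * (y.1 * starRingEnd ℂ y.2.1 * y.2.2).re)

/-- The conservation laws of the reduced system, up to a change of time. -/
theorem invariants_eq {α l : ℝ} {γ : ℝ → ℂ × ℂ × ℂ} {k : ℝ → ℝ}
    (hγ : ∀ t, HasDerivAt γ (k t • field α l (γ t)) t) (t : ℝ) :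
    invariants α l (γ t) = invariants α l (γ 0) := by
  have hb : ∀ t, HasDerivAt (fun s => (γ s).1) _ t := fun t => (hγ t).fst
  have hc : ∀ t, HasDerivAt (fun s => (γ s).2.1) _ t := fun t => (hγ t).snd.fst
  have hp : ∀ t, HasDerivAt (fun s => (γ s).2.2) _ t := fun t => (hγ t).snd.snd
  have hb' := fun t => HasDerivAt.conj_complex (hb t)
  have hc' := fun t => HasDerivAt.conj_complex (hc t)
  have hp' := fun t => HasDerivAt.conj_complex (hp t)
  have hX := fun t => ((hp t).mul (hp' t)).const_sub 1
  have hJ1 := eq_of_hasDerivAt_zero (f := fun s => (γ s).2.1 * starRingEnd ℂ (γ s).2.1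
    - (l : ℂ) ^ 2 * (1 - (γ s).2.2 * starRingEnd ℂ (γ s).2.2) ^ 2) (fun t =>
      (((hc t).mul (hc' t)).sub (((hX t).pow 2).const_mul ((l : ℂ) ^ 2))).congr_deriv (by
        simp [field, Complex.conj_ofNat]
        ring)) t
  have hJ2 := eq_of_hasDerivAt_zero (f := fun s => (γ s).1 * starRingEnd ℂ (γ s).1
    + (l : ℂ) ^ 2 * (1 - (γ s).2.2 * starRingEnd ℂ (γ s).2.2)) (fun t =>
      (((hb t).mul (hb' t)).add ((hX t).const_mul ((l : ℂ) ^ 2))).congr_deriv (by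
        simp [field, Complex.conj_ofNat]
        ring)) t
  -- When `|c| = lx`, with `x = 1 - |p|²` and mass `Q`, this quantity times `l²` equals `‖u‖₄⁴ +
  -- 2α|b|² - Q² - 2αQ`: it is the Hamiltonian, up to the other conserved quantities.
  have hJ3 := eq_of_hasDerivAt_zero
    (f := fun s => (1 - (γ s).2.2 * starRingEnd ℂ (γ s).2.2)
      * ((-2 * (α : ℂ) + 2 * (l : ℂ) ^ 2) + 2 * ((γ s).1 * starRingEnd ℂ (γ s).1)
        - 2 * (l : ℂ) ^ 2 * (1 - (γ s).2.2 * starRingEnd ℂ (γ s).2.2))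
      + 2 * ((γ s).1 * starRingEnd ℂ (γ s).2.1 * (γ s).2.2
        + starRingEnd ℂ (γ s).1 * (γ s).2.1 * starRingEnd ℂ (γ s).2.2)) (fun t =>
      (((hX t).mul (((((hb t).mul (hb' t)).const_mul 2).const_add _).sub
          ((hX t).const_mul (2 * (l : ℂ) ^ 2)))).add
        (((((hb t).mul (hc' t)).mul (hp t)).add
          (((hb' t).mul (hc t)).mul (hp' t))).const_mul 2)).congr_deriv (by
        simp [field, Complex.conj_ofNat]
        ring)) t
  simp only [Complex.mul_conj'] at hJ1 hJ2 hJ3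
  have hre : ∀ b c p : ℂ, b * starRingEnd ℂ c * p + starRingEnd ℂ b * c * starRingEnd ℂ p
      = ((2 * (b * starRingEnd ℂ c * p).re : ℝ) : ℂ) := by
    intro b c p
    rw [← Complex.add_conj]
    simp
  simp only [hre] at hJ3
  refine Prod.ext ?_ (Prod.ext ?_ ?_)
  · exact_mod_cast hJ1
  · exact_mod_cast hJ2
  · have h3 : (1 - ‖(γ t).2.2‖ ^ 2) * ((-2 * α + 2 * l ^ 2) + 2 * ‖(γ t).1‖ ^ 2
          - 2 * l ^ 2 * (1 - ‖(γ t).2.2‖ ^ 2))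
          + 2 * (2 * ((γ t).1 * starRingEnd ℂ (γ t).2.1 * (γ t).2.2).re)
        = (1 - ‖(γ 0).2.2‖ ^ 2) * ((-2 * α + 2 * l ^ 2) + 2 * ‖(γ 0).1‖ ^ 2
          - 2 * l ^ 2 * (1 - ‖(γ 0).2.2‖ ^ 2))
          + 2 * (2 * ((γ 0).1 * starRingEnd ℂ (γ 0).2.1 * (γ 0).2.2).re) := by
      exact_mod_cast hJ3
    simp only [invariants]
    linear_combination h3

/-- A priori bounds for small data: `1 - |p|²` stays bounded below. -/
theorem reduced_bounds {α l Q : ℝ} (hα : 0 < α) (hl : 0 < l) (hl2 : l ^ 2 ≤ α / 16)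
    (hQ2 : Q ≤ α / 16) {γ : ℝ → ℂ × ℂ × ℂ} (hcont : Continuous γ)
    (hinv : ∀ t, invariants α l (γ t) = invariants α l (γ 0))
    (hp0 : ‖(γ 0).2.2‖ < 1) (hc0 : ‖(γ 0).2.1‖ = l * (1 - ‖(γ 0).2.2‖ ^ 2))
    (hQ : ‖(γ 0).1‖ ^ 2 + l ^ 2 * (1 - ‖(γ 0).2.2‖ ^ 2) = Q) (t : ℝ) :
    (1 - ‖(γ 0).2.2‖ ^ 2) / 3 ≤ 1 - ‖(γ t).2.2‖ ^ 2 ∧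
      ‖(γ t).2.1‖ = l * (1 - ‖(γ t).2.2‖ ^ 2) ∧
      ‖(γ t).1‖ ^ 2 + l ^ 2 * (1 - ‖(γ t).2.2‖ ^ 2) = Q := by
  set x : ℝ → ℝ := fun t => 1 - ‖(γ t).2.2‖ ^ 2 with hx
  have hxc : Continuous x := by fun_prop
  have hx1 : ∀ t, x t ≤ 1 := fun t => by simp only [hx]; nlinarith [sq_nonneg ‖(γ t).2.2‖]
  have hx0 : 0 < x 0 := by
    simp only [hx]
    nlinarith [norm_nonneg (γ 0).2.2]
  have h1 : ∀ t, ‖(γ t).2.1‖ ^ 2 = (l * x t) ^ 2 := by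
    intro t
    have := congrArg Prod.fst (hinv t)
    simp only [invariants, hc0] at this
    simp only [hx]
    linarith
  have h2 : ∀ t, ‖(γ t).1‖ ^ 2 + l ^ 2 * x t = Q := by
    intro t
    have := congrArg (fun z => z.2.1) (hinv t)
    simp only [invariants, hQ] at this
    exact this
  set C : ℝ := (invariants α l (γ 0)).2.2 with hC
  have h3 : ∀ t, x t * (-2 * α + 2 * Q + 2 * l ^ 2 - 4 * l ^ 2 * x t)
      + 4 * ((γ t).1 * starRingEnd ℂ (γ t).2.1 * (γ t).2.2).re = C := by
    intro t
    rw [hC, ← hinv t, ← h2 t]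
    rfl
  -- Apart from `-2αx`, the first term of `C` is at most `αx/4` in size and so is the term with the
  -- real part, whence the constants `2 ± 1/2`.
  have hest : ∀ t, 0 < x t → ‖(γ t).2.1‖ = l * x t ∧ -(5 / 2) * α * x t ≤ C ∧
      C ≤ -(3 / 2) * α * x t := by
    intro t ht
    have hc : ‖(γ t).2.1‖ = l * x t :=
      (sq_eq_sq₀ (norm_nonneg _) (by positivity)).mp (h1 t)
    have hp : ‖(γ t).2.2‖ ≤ 1 := by
      have : ‖(γ t).2.2‖ ^ 2 ≤ 1 := by simp only [hx] at ht; linarith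
      nlinarith [norm_nonneg (γ t).2.2]
    have hbl : ‖(γ t).1‖ * l ≤ α / 16 := by
      have : ‖(γ t).1‖ ^ 2 ≤ α / 16 := by nlinarith [h2 t, mul_pos (pow_pos hl 2) ht]
      nlinarith [sq_nonneg (‖(γ t).1‖ - l)]
    have hm : |((γ t).1 * starRingEnd ℂ (γ t).2.1 * (γ t).2.2).re| ≤ α / 16 * x t := by
      refine (Complex.abs_re_le_norm _).trans ?_
      rw [norm_mul, norm_mul, RCLike.norm_conj, hc]
      calc ‖(γ t).1‖ * (l * x t) * ‖(γ t).2.2‖ ≤ ‖(γ t).1‖ * (l * x t) * 1 := by gcongr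
        _ = (‖(γ t).1‖ * l) * x t := by ring
        _ ≤ _ := by gcongr
    have hQ0 : 0 ≤ Q := by rw [← h2 t]; positivity
    have hlx : l ^ 2 * x t ≤ l ^ 2 := by nlinarith [hx1 t, sq_nonneg l]
    have hlx0 : 0 < l ^ 2 * x t := by positivity
    obtain ⟨hm1, hm2⟩ := abs_le.mp hm
    have h4 : x t * (2 * Q + 2 * l ^ 2 - 4 * (l ^ 2 * x t)) ≤ x t * (α / 4) := by
      gcongr; linarith
    have h5 : x t * (-(α / 4)) ≤ x t * (2 * Q + 2 * l ^ 2 - 4 * (l ^ 2 * x t)) := by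
      gcongr; linarith
    refine ⟨hc, ?_, ?_⟩ <;> nlinarith [h3 t, mul_pos hα ht]
  have hC0 : C < 0 := by
    have := (hest 0 hx0).2.2
    nlinarith [mul_pos hα hx0]
  -- At `x = 0` the first invariant forces `c = 0`, hence `C = 0`, against `C < 0`. By continuity
  -- `x` never changes sign, so the orbit cannot leave the disk.
  have hxne : ∀ t, x t ≠ 0 := by
    intro t h0
    have hc : (γ t).2.1 = 0 := by
      have := h1 t
      rw [h0] at this
      simpa using this
    have := h3 t
    rw [h0, hc] at this
    simp at this
    linarith
  have hpos : ∀ t, 0 < x t := by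
    intro t
    by_contra hneg
    push Not at hneg
    obtain ⟨s, hs⟩ := mem_range_of_exists_le_of_exists_ge hxc ⟨t, hneg⟩ ⟨0, hx0.le⟩
    exact hxne s hs
  obtain ⟨hc, hlo, -⟩ := hest t (hpos t)
  refine ⟨?_, hc, h2 t⟩
  have h6 := (hest 0 hx0).2.2
  have h7 : α * (x 0 / 3) ≤ α * x t := by
    nlinarith [mul_pos hα hx0, mul_pos hα (hpos t)]
  exact le_of_mul_le_mul_left h7 hα

/-- The invariants bound the cutoff orbit by `Q + l + 1`, inside the region where the cutoff is `1`.
-/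
theorem exists_reduced_solution {α l Q : ℝ} (hα : 0 < α) (hl : 0 < l) (hl2 : l ^ 2 ≤ α / 16)
    (hQ2 : Q ≤ α / 16) {b₀ c₀ p₀ : ℂ} (hp0 : ‖p₀‖ < 1) (hc0 : ‖c₀‖ = l * (1 - ‖p₀‖ ^ 2))
    (hQ : ‖b₀‖ ^ 2 + l ^ 2 * (1 - ‖p₀‖ ^ 2) = Q) :
    ∃ γ : ℝ → ℂ × ℂ × ℂ, γ 0 = (b₀, c₀, p₀) ∧ (∀ t, HasDerivAt γ (field α l (γ t)) t) ∧
      ∀ t, (1 - ‖p₀‖ ^ 2) / 3 ≤ 1 - ‖(γ t).2.2‖ ^ 2 ∧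
        ‖(γ t).2.1‖ = l * (1 - ‖(γ t).2.2‖ ^ 2) ∧
        ‖(γ t).1‖ ^ 2 + l ^ 2 * (1 - ‖(γ t).2.2‖ ^ 2) = Q := by
  have hx0 : 0 < 1 - ‖p₀‖ ^ 2 := by nlinarith [norm_nonneg p₀]
  have hQ0 : 0 ≤ Q := by rw [← hQ]; positivity
  obtain ⟨γ, k, h0, hγ, hk⟩ := exists_global_cutoff_solution (contDiff_field α l)
    (R := Q + l + 1) (by positivity) (b₀, c₀, p₀)
  have hcont : Continuous γ := continuous_iff_continuousAt.mpr fun t => (hγ t).continuousAt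
  have hb := reduced_bounds hα hl hl2 hQ2 hcont (invariants_eq hγ) (by rw [h0]; exact hp0)
    (by rw [h0]; exact hc0) (by rw [h0]; exact hQ)
  rw [h0] at hb
  refine ⟨γ, h0, fun t => ?_, hb⟩
  obtain ⟨h1, h2, h3⟩ := hb t
  have hxt : 0 < 1 - ‖(γ t).2.2‖ ^ 2 := by
    have : 0 < (1 - ‖p₀‖ ^ 2) / 3 := by positivity
    exact this.trans_le h1
  have hnorm : ‖γ t‖ ≤ Q + l + 1 := by
    have hpn := norm_nonneg (γ t).2.2
    have hbn := norm_nonneg (γ t).1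
    refine max_le ?_ (max_le ?_ ?_)
    · have : ‖(γ t).1‖ ^ 2 ≤ Q := by nlinarith [mul_pos (pow_pos hl 2) hxt]
      nlinarith [sq_nonneg (‖(γ t).1‖ - 1)]
    · rw [h2]; nlinarith [sq_nonneg ‖(γ t).2.2‖]
    · nlinarith
  have := hγ t
  rwa [hk _ hnorm, one_smul] at this

/-! ### Rational functions with one pole -/

/-- The Cauchy kernel `1 / (1 - p z)` as a continuous function on the circle. -/
def kernel (p : ℂ) : C(Torus, ℂ) := Ring.inverse (1 - p • (fourier 1 : C(Torus, ℂ)))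

/-- The function `z / (1 - p z)`. -/
def shiftKernel (p : ℂ) : C(Torus, ℂ) := fourier 1 * kernel p

/-- The function `b + c z / (1 - p z)`. -/
def ratFun (y : ℂ × ℂ × ℂ) : C(Torus, ℂ) :=
  y.1 • (1 : C(Torus, ℂ)) + y.2.1 • shiftKernel y.2.2

theorem norm_smul_fourier_lt {p : ℂ} (hp : ‖p‖ < 1) : ‖p • (fourier 1 : C(Torus, ℂ))‖ < 1 := by
  rw [norm_smul, fourier_norm, mul_one]; exact hp

theorem isUnit_one_sub_smul {p : ℂ} (hp : ‖p‖ < 1) :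
    IsUnit (1 - p • (fourier 1 : C(Torus, ℂ))) :=
  isUnit_one_sub_of_norm_lt_one (norm_smul_fourier_lt hp)

theorem kernel_mul {p : ℂ} (hp : ‖p‖ < 1) :
    kernel p * (1 - p • (fourier 1 : C(Torus, ℂ))) = 1 :=
  Ring.inverse_mul_cancel _ (isUnit_one_sub_smul hp)

theorem one_sub_mul_fourier_ne_zero {p : ℂ} (hp : ‖p‖ < 1) (x : Torus) :
    1 - p * (fourier 1 : C(Torus, ℂ)) x ≠ 0 := by
  intro h
  have h1 : ‖p * (fourier 1 : C(Torus, ℂ)) x‖ = 1 := by rw [← sub_eq_zero.mp h, norm_one]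
  rw [norm_mul, norm_fourier_apply, mul_one] at h1
  linarith

theorem kernel_apply {p : ℂ} (hp : ‖p‖ < 1) (x : Torus) :
    kernel p x = 1 / (1 - p * (fourier 1 : C(Torus, ℂ)) x) := by
  rw [eq_div_iff (one_sub_mul_fourier_ne_zero hp x)]
  exact congrArg (fun f : C(Torus, ℂ) => f x) (kernel_mul hp)

theorem shiftKernel_apply {p : ℂ} (hp : ‖p‖ < 1) (x : Torus) :
    shiftKernel p x = (fourier 1 : C(Torus, ℂ)) x / (1 - p * (fourier 1 : C(Torus, ℂ)) x) := by
  rw [shiftKernel, ContinuousMap.mul_apply, kernel_apply hp, mul_one_div]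

theorem ratFun_apply {b c p : ℂ} (hp : ‖p‖ < 1) (x : Torus) :
    ratFun (b, c, p) x = b + c * (fourier 1 : C(Torus, ℂ)) x
      / (1 - p * (fourier 1 : C(Torus, ℂ)) x) := by
  simp only [ratFun, ContinuousMap.add_apply, ContinuousMap.smul_apply, ContinuousMap.one_apply,
    shiftKernel_apply hp, smul_eq_mul, mul_one, mul_div_assoc]

/-- Inversion is differentiable at units of the Banach algebra of continuous functions, so the
derivative in `p` holds uniformly on the circle. -/
theorem hasDerivAt_kernel {p : ℝ → ℂ} {p' : ℂ} {t : ℝ} (hp : HasDerivAt p p' t) (h1 : ‖p t‖ < 1) :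
    HasDerivAt (fun s => kernel (p s)) (p' • (fourier 1 * kernel (p t) ^ 2)) t := by
  obtain ⟨U, hU⟩ := isUnit_one_sub_smul h1
  have h2 : HasDerivAt (fun s => 1 - p s • (fourier 1 : C(Torus, ℂ)))
      (-(p' • (fourier 1 : C(Torus, ℂ)))) t := (hp.smul_const _).const_sub 1
  have h3 := hasFDerivAt_ringInverse (𝕜 := ℝ) U
  rw [hU] at h3
  have h4 := h3.comp_hasDerivAt t h2
  have hk : ((U⁻¹ : (C(Torus, ℂ))ˣ) : C(Torus, ℂ)) = kernel (p t) := by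
    rw [kernel, ← hU, Ring.inverse_unit]
  refine h4.congr_deriv ?_
  rw [hk]
  ext x
  simp only [_root_.neg_apply, ContinuousLinearMap.mulLeftRight_apply,
    ContinuousMap.neg_apply, ContinuousMap.mul_apply, ContinuousMap.smul_apply,
    ContinuousMap.pow_apply, smul_eq_mul]
  ring

theorem hasDerivAt_ratFun {γ : ℝ → ℂ × ℂ × ℂ} {v : ℂ × ℂ × ℂ} {t : ℝ} (h : HasDerivAt γ v t)
    (h1 : ‖(γ t).2.2‖ < 1) :
    HasDerivAt (fun s => ratFun (γ s)) (v.1 • (1 : C(Torus, ℂ)) + v.2.1 • shiftKernel (γ t).2.2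
      + ((γ t).2.1 * v.2.2) • shiftKernel (γ t).2.2 ^ 2) t := by
  have hb : HasDerivAt (fun s => (γ s).1) v.1 t := h.fst
  have hc : HasDerivAt (fun s => (γ s).2.1) v.2.1 t := h.snd.fst
  have hp : HasDerivAt (fun s => (γ s).2.2) v.2.2 t := h.snd.snd
  have hk := (hasDerivAt_kernel hp h1).const_mul (fourier 1 : C(Torus, ℂ))
  refine ((hb.smul_const (1 : C(Torus, ℂ))).add (hc.smul hk)).congr_deriv ?_
  ext x
  simp [shiftKernel]
  ring

theorem norm_coeffL_le (n : ℤ) (u : L2) : ‖coeffL n u‖ ≤ ‖u‖ := by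
  have := le_hasSum (hasSum_norm_sq_coeffL u) n (fun _ _ => by positivity)
  exact (sq_le_sq₀ (norm_nonneg _) (norm_nonneg _)).mp this

theorem coeffL_fourier_mul (f : C(Torus, ℂ)) (n : ℤ) :
    coeffL n (toL2 (fourier 1 * f)) = coeffL (n - 1) (toL2 f) := by
  rw [coeffL_toL2, coeffL_toL2, ← fourierCoeff_fourier_mul]
  rfl

theorem coeffL_mul_one_sub (f : C(Torus, ℂ)) (p : ℂ) (n : ℤ) :
    coeffL n (toL2 (f * (1 - p • (fourier 1 : C(Torus, ℂ)))))
      = coeffL n (toL2 f) - p * coeffL (n - 1) (toL2 f) := by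
  have : f * (1 - p • (fourier 1 : C(Torus, ℂ))) = f - p • (fourier 1 * f) := by
    ext x; simp; ring
  rw [this, map_sub, map_sub, map_smul, map_smul, coeffL_fourier_mul, smul_eq_mul]

/-- At negative `n` the coefficients satisfy `f̂(n) = p f̂(n - 1)`; iterating towards `-∞` with
bounded coefficients and `|p| < 1` forces them to vanish. -/
theorem mem_hardy_of_mul_one_sub {f : C(Torus, ℂ)} {p : ℂ} (hp : ‖p‖ < 1)
    (h : toL2 (f * (1 - p • (fourier 1 : C(Torus, ℂ)))) ∈ hardy) : toL2 f ∈ hardy := by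
  rw [mem_hardy] at *
  intro n hn
  have h1 : ∀ k : ℕ, coeffL n (toL2 f) = p ^ k * coeffL (n - k) (toL2 f) := by
    intro k
    induction k with
    | zero => simp
    | succ k ih =>
      have h2 := h (n - k) (by omega)
      rw [coeffL_mul_one_sub, sub_eq_zero] at h2
      rw [ih, h2, pow_succ, mul_assoc]
      push_cast
      rw [sub_sub]
  have h3 : Tendsto (fun k : ℕ => ‖p‖ ^ k * ‖toL2 f‖) atTop (𝓝 0) := by
    simpa using (tendsto_pow_atTop_nhds_zero_of_lt_one (norm_nonneg p) hp).mul_const ‖toL2 f‖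
  have h4 : ‖coeffL n (toL2 f)‖ ≤ 0 := by
    refine ge_of_tendsto h3 (Eventually.of_forall fun k => ?_)
    rw [h1 k, norm_mul, norm_pow]
    gcongr
    exact norm_coeffL_le _ _
  exact norm_le_zero_iff.mp h4

theorem coeffL_fourier (m n : ℤ) : coeffL n (toL2 (fourier m)) = if n = m then 1 else 0 := by
  rw [coeffL_toL2, fourierCoeff_fourier, Pi.single_apply]

theorem coeffL_one (n : ℤ) : coeffL n (toL2 1) = if n = 0 then 1 else 0 := by
  rw [← coeffL_fourier, show (1 : C(Torus, ℂ)) = fourier 0 by ext; simp]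

theorem shiftKernel_mul {p : ℂ} (hp : ‖p‖ < 1) :
    shiftKernel p * (1 - p • (fourier 1 : C(Torus, ℂ))) = fourier 1 := by
  rw [shiftKernel, mul_assoc, kernel_mul hp, mul_one]

theorem shiftKernel_mem_hardy {p : ℂ} (hp : ‖p‖ < 1) : toL2 (shiftKernel p) ∈ hardy := by
  apply mem_hardy_of_mul_one_sub hp
  rw [shiftKernel_mul hp, mem_hardy]
  intro n hn
  rw [coeffL_fourier, if_neg (by omega)]

theorem coeffL_shiftKernel_zero {p : ℂ} (hp : ‖p‖ < 1) : coeffL 0 (toL2 (shiftKernel p)) = 0 := by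
  have h := coeffL_mul_one_sub (shiftKernel p) p 0
  rw [shiftKernel_mul hp, coeffL_fourier, if_neg (by norm_num),
    mem_hardy.mp (shiftKernel_mem_hardy hp) (0 - 1) (by norm_num), mul_zero, sub_zero] at h
  exact h.symm

theorem coeffL_shiftKernel_succ {p : ℂ} (hp : ‖p‖ < 1) (n : ℕ) :
    coeffL (n + 1 : ℤ) (toL2 (shiftKernel p)) = p ^ n := by
  have h := fun n : ℤ => coeffL_mul_one_sub (shiftKernel p) p n
  rw [shiftKernel_mul hp] at h
  induction n with
  | zero =>
    have h1 := h 1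
    rw [coeffL_fourier, if_pos rfl, sub_self, coeffL_shiftKernel_zero hp] at h1
    simpa using h1.symm
  | succ n ih =>
    have h1 := h (n + 1 + 1)
    rw [coeffL_fourier, if_neg (by omega), add_sub_cancel_right, ih] at h1
    push_cast
    linear_combination -h1

theorem shiftKernel_sq_mem_hardy {p : ℂ} (hp : ‖p‖ < 1) : toL2 (shiftKernel p ^ 2) ∈ hardy := by
  apply mem_hardy_of_mul_one_sub hp
  rw [pow_two, mul_assoc, shiftKernel_mul hp, mul_comm (shiftKernel p), mem_hardy]
  intro n hn
  rw [coeffL_fourier_mul]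
  exact mem_hardy.mp (shiftKernel_mem_hardy hp) _ (by omega)

theorem coeffL_ratFun (b c p : ℂ) (n : ℤ) :
    coeffL n (toL2 (ratFun (b, c, p)))
      = b * (if n = 0 then 1 else 0) + c * coeffL n (toL2 (shiftKernel p)) := by
  rw [ratFun, map_add, map_smul, map_smul, map_add, map_smul, map_smul, coeffL_one]
  rfl

theorem coeffL_ratFun_zero {b c p : ℂ} (hp : ‖p‖ < 1) :
    coeffL 0 (toL2 (ratFun (b, c, p))) = b := by
  rw [coeffL_ratFun, coeffL_shiftKernel_zero hp]
  simp

theorem coeffL_ratFun_succ {b c p : ℂ} (hp : ‖p‖ < 1) (n : ℕ) :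
    coeffL (n + 1 : ℤ) (toL2 (ratFun (b, c, p))) = c * p ^ n := by
  rw [coeffL_ratFun, coeffL_shiftKernel_succ hp, if_neg (by omega)]
  simp

theorem ratFun_mem_hardy {b c p : ℂ} (hp : ‖p‖ < 1) : toL2 (ratFun (b, c, p)) ∈ hardy := by
  rw [mem_hardy]
  intro n hn
  rw [coeffL_ratFun, mem_hardy.mp (shiftKernel_mem_hardy hp) n hn, if_neg (by omega)]
  simp

theorem isRational_toL2 {b c p : ℂ} (hp : ‖p‖ < 1) : IsRational (toL2 (ratFun (b, c, p))) b c p := by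
  filter_upwards [coe_toL2 (ratFun (b, c, p))] with x hx
  rw [hx, ratFun_apply hp]

/-- The Szegő projection of `|u|² u` for `u = b + c z / (1 - p z)` with `|c| = l (1 - |p|²)`. -/
def ratCubic (l : ℝ) (y : ℂ × ℂ × ℂ) : C(Torus, ℂ) :=
  let b := y.1
  let c := y.2.1
  let p := y.2.2
  let b' := starRingEnd ℂ b
  let p' := starRingEnd ℂ p
  (b * b' * b + 2 * l ^ 2 * (1 - p * p') * b + l ^ 2 * c * p') • (1 : C(Torus, ℂ))
    + (2 * b * b' * c + l ^ 2 * c + 2 * l ^ 2 * (1 - p * p') * b * p) • shiftKernel p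
    + (c * (b' * c + l ^ 2 * (1 - p * p') * p)) • shiftKernel p ^ 2

theorem ratCubic_mem_hardy (l : ℝ) {y : ℂ × ℂ × ℂ} (hp : ‖y.2.2‖ < 1) :
    toL2 (ratCubic l y) ∈ hardy := by
  rw [mem_hardy]
  intro n hn
  simp only [ratCubic, map_add, map_smul, coeffL_one, if_neg hn.ne,
    mem_hardy.mp (shiftKernel_mem_hardy hp) n hn, mem_hardy.mp (shiftKernel_sq_mem_hardy hp) n hn,
    smul_zero, add_zero]

/-- The algebraic identity behind the computation of `Π(|u|² u)`. -/
theorem cubic_rational_identity {b c p b' c' p' z z' L x : ℂ} (hz : z * z' = 1) (hx : x = 1 - p * p')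
    (hx0 : x ≠ 0) (hd : 1 - p * z ≠ 0) (hd' : 1 - p' * z' ≠ 0) (hL : L * x ^ 2 = c * c') :
    (b + c * z / (1 - p * z)) * (b' + c' * (z' / (1 - p' * z'))) * (b + c * z / (1 - p * z))
      = ((b * b' * b + 2 * L * x * b + L * c * p')
        + (2 * b * b' * c + L * c + 2 * L * x * b * p) * (z / (1 - p * z))
        + c * (b' * c + L * x * p) * (z / (1 - p * z)) ^ 2)
        + c' * (b + c * p' / x) ^ 2 * (z' / (1 - p' * z')) := by
  have hz0 : z ≠ 0 := left_ne_zero_of_mul_eq_one hz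
  have hz' : z' = z⁻¹ := eq_inv_of_mul_eq_one_right hz
  have hq : z - p' ≠ 0 := by
    intro h
    apply hd'
    rw [hz', ← sub_eq_zero.mp h, mul_inv_cancel₀ hz0, sub_self]
  have hk : z' / (1 - p' * z') = 1 / (z - p') := by
    rw [div_eq_div_iff hd' hq, hz']
    field_simp
  have hL' : L = c * c' / x ^ 2 := by rw [← hL]; field_simp
  rw [hk, hL']
  obtain ⟨d, hdd⟩ : ∃ d, d = 1 - p * z := ⟨_, rfl⟩
  obtain ⟨q, hqq⟩ : ∃ q, q = z - p' := ⟨_, rfl⟩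
  rw [← hdd] at hd ⊢
  rw [← hqq] at hq ⊢
  field_simp
  rw [hx, hdd, hqq]
  ring

theorem isSzegoProj_ratCubic {l : ℝ} {b c p : ℂ} (hp : ‖p‖ < 1) (hc : ‖c‖ = l * (1 - ‖p‖ ^ 2)) :
    IsSzegoProj (cubic (toL2 (ratFun (b, c, p)))) (toL2 (ratCubic l (b, c, p))) := by
  set U := ratFun (b, c, p) with hU
  set x : ℂ := 1 - p * starRingEnd ℂ p with hx
  have hxr : x = ((1 - ‖p‖ ^ 2 : ℝ) : ℂ) := by rw [hx, Complex.mul_conj']; push_cast; rfl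
  have hx0 : x ≠ 0 := by
    rw [hxr, Complex.ofReal_ne_zero]
    nlinarith [norm_nonneg p]
  -- This is `c̄ u(p̄)²`, the coefficient of the pole at `p̄`; the conjugate of `shiftKernel p` has
  -- only frequencies `≤ -1`, so `Π` removes it.
  set k : ℂ := starRingEnd ℂ c * (b + c * starRingEnd ℂ p / x) ^ 2 with hk
  have hpt : ∀ θ : Torus, (‖U θ‖ : ℂ) ^ 2 * U θ
      = ratCubic l (b, c, p) θ + k * starRingEnd ℂ (shiftKernel p θ) := by
    intro θ
    set z := (fourier 1 : C(Torus, ℂ)) θ with hz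
    have hd := one_sub_mul_fourier_ne_zero hp θ
    have h1 := cubic_rational_identity (b := b) (c := c) (p := p) (b' := starRingEnd ℂ b)
      (c' := starRingEnd ℂ c) (p' := starRingEnd ℂ p) (z := z) (z' := starRingEnd ℂ z)
      (L := (l : ℂ) ^ 2) (x := x)
      (by rw [Complex.mul_conj', hz, norm_fourier_apply]; simp) hx hx0 hd
      (by
        have := (map_ne_zero (starRingEnd ℂ)).mpr hd
        rwa [map_sub, map_one, map_mul] at this)
      (by
        rw [Complex.mul_conj', hc, hxr]; push_cast; ring)
    rw [← Complex.mul_conj', hU, ratFun_apply hp, ← hz]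
    simp only [ratCubic, ContinuousMap.add_apply, ContinuousMap.smul_apply, ContinuousMap.one_apply,
      ContinuousMap.pow_apply, shiftKernel_apply hp, smul_eq_mul, mul_one, ← hz, ← hx]
    rw [hk, map_div₀, map_sub, map_mul, map_one, ← h1, map_add, map_div₀, map_mul, map_sub, map_mul,
      map_one, mul_div_assoc (starRingEnd ℂ c)]
  have hae : cubic (toL2 U) =ᵐ[haarAddCircle]
      fun θ => ratCubic l (b, c, p) θ + k * starRingEnd ℂ (shiftKernel p θ) := by
    filter_upwards [coe_toL2 U] with θ h
    simp only [cubic]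
    rw [h, hpt]
  have hi1 := integrable_continuousMap (ratCubic l (b, c, p))
  have hi2 : Integrable (fun θ => starRingEnd ℂ (shiftKernel p θ)) haarAddCircle :=
    integrable_continuousMap (star (shiftKernel p))
  refine ⟨(integrable_congr hae).mpr (hi1.add (hi2.const_mul k)), fun n => ?_⟩
  rw [fourierCoeff_congr_ae hae, ← coeffL_apply]
  split_ifs with hn
  · have h1 := congrFun (fourierCoeff.add hi1 (hi2.const_mul k)) n
    have h2 : coeffL (-n) (toL2 (shiftKernel p)) = 0 := by
      rcases hn.eq_or_lt with h | h
      · rw [← h, neg_zero, coeffL_shiftKernel_zero hp]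
      · exact mem_hardy.mp (shiftKernel_mem_hardy hp) _ (by omega)
    rw [Pi.add_apply, fourierCoeff.const_mul, fourierCoeff_conj, ← coeffL_toL2, ← coeffL_toL2, h2,
      map_zero, mul_zero, add_zero] at h1
    exact h1.symm
  · exact mem_hardy.mp (ratCubic_mem_hardy l hp) n (by omega)

/-! ### Rank one data -/

theorem exists_coeffL_eq {a : ℤ → ℂ} (ha : Summable fun n => ‖a n‖ ^ 2) :
    ∃ g : L2, ∀ n, coeffL n g = a n := by
  have hm : Memℓp a 2 := by
    apply memℓp_gen
    simpa using ha
  refine ⟨fourierBasis.repr.symm ⟨a, hm⟩, fun n => ?_⟩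
  rw [coeffL_apply, ← fourierBasis_repr, LinearIsometryEquiv.apply_symm_apply]

/-- Testing `K_u` on `z^m` yields the `m`-th column of the Hankel matrix `û(n + m + 1)`. -/
theorem exists_isShiftedHankel_fourier (u : L2) (m : ℕ) :
    ∃ h ∈ hardy, ∃ k, IsShiftedHankel u h k ∧ ∀ n : ℕ, coeffL n k = coeffL (n + 1 + m : ℤ) u := by
  have hs : Summable fun n : ℤ => ‖coeffL n u‖ ^ 2 := (hasSum_norm_sq_coeffL u).summable
  have key : ∀ j : ℤ, Summable fun n : ℤ => ‖(if 0 ≤ n then coeffL (n + j) u else 0)‖ ^ 2 := by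
    intro j
    refine Summable.of_nonneg_of_le (fun _ => by positivity) (fun n => ?_)
      (hs.comp_injective (add_left_injective j))
    split_ifs
    · exact le_rfl
    · simp
  obtain ⟨g, hg⟩ := exists_coeffL_eq (key m)
  obtain ⟨k, hk⟩ := exists_coeffL_eq (key (1 + m))
  have hui : Integrable u haarAddCircle := (Lp.memLp u).integrable (by norm_num)
  have hgi : Integrable g haarAddCircle := (Lp.memLp g).integrable (by norm_num)
  have e1 : (fun x => u x * starRingEnd ℂ (toL2 (fourier (m : ℤ)) x)) =ᵐ[haarAddCircle]
      fun x => (fourier (-m : ℤ) : C(Torus, ℂ)) x * u x := by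
    filter_upwards [coe_toL2 (fourier (m : ℤ))] with x hx
    rw [hx, fourier_neg, mul_comm]
  have e2 : (fun x => starRingEnd ℂ ((fourier 1 : C(Torus, ℂ)) x) * g x)
      = fun x => (fourier (-1 : ℤ) : C(Torus, ℂ)) x * g x := by
    ext x; rw [fourier_neg]
  refine ⟨toL2 (fourier (m : ℤ)), ?_, k, ⟨g, ⟨?_, fun n => ?_⟩, ?_, fun n => ?_⟩, fun n => ?_⟩
  · rw [mem_hardy]
    intro n hn
    rw [coeffL_fourier, if_neg (by omega)]
  · rw [integrable_congr e1]
    exact hui.fourier_smul (-m : ℤ)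
  · rw [fourierCoeff_congr_ae e1, fourierCoeff_fourier_mul, ← coeffL_apply, ← coeffL_apply, hg,
      sub_neg_eq_add]
  · rw [e2]
    exact hgi.fourier_smul (-1)
  · rw [e2, fourierCoeff_fourier_mul, ← coeffL_apply, ← coeffL_apply, hk, hg]
    by_cases h : 0 ≤ n
    · rw [if_pos h, if_pos h, if_pos (by omega)]
      congr 2
      ring
    · rw [if_neg h, if_neg h]
  · rw [hk, if_pos (by positivity), add_assoc]

/-- Kronecker's theorem in rank one: proportional columns `m = 0` and `m = 1` make `û(n + 1)` a
geometric sequence of ratio `p = a'/a`. -/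
theorem exists_ratFun_of_mem_calL {u : L2} (hu : u ∈ calL 1) :
    ∃ b c p : ℂ, c ≠ 0 ∧ ‖p‖ < 1 ∧ u = toL2 (ratFun (b, c, p)) := by
  obtain ⟨⟨hh, -⟩, hr⟩ := hu
  have hr' : Module.rank ℂ (Submodule.span ℂ {k : L2 | ∃ h ∈ hardy, IsShiftedHankel u h k}) = 1 := by
    simpa [rankK] using hr
  obtain ⟨v, hv, hv0, hle⟩ := (rank_submodule_eq_one_iff _).mp hr'
  have hcoef : ∀ m : ℕ, ∃ a : ℂ, ∀ n : ℕ, coeffL (n + 1 + m : ℤ) u = a * coeffL n v := by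
    intro m
    obtain ⟨h, hh, k, hk, hkc⟩ := exists_isShiftedHankel_fourier u m
    obtain ⟨a, ha⟩ := Submodule.mem_span_singleton.mp (hle (Submodule.subset_span ⟨h, hh, hk⟩))
    refine ⟨a, fun n => ?_⟩
    rw [← hkc, ← ha, map_smul, smul_eq_mul]
  -- Otherwise `u` is constant and `K_u = 0`, contradicting rank one.
  have hne : ¬ ∀ n : ℕ, coeffL (n + 1 : ℤ) u = 0 := by
    intro hz
    have huc : u = toL2 (coeffL 0 u • (1 : C(Torus, ℂ))) := by
      apply ext_coeffL
      intro n
      rw [map_smul, map_smul, coeffL_one]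
      rcases lt_trichotomy n 0 with h | h | h
      · rw [mem_hardy.mp hh n h, if_neg h.ne, smul_zero]
      · rw [h, if_pos rfl, smul_eq_mul, mul_one]
      · obtain ⟨k, rfl⟩ : ∃ k : ℕ, n = k + 1 := ⟨(n - 1).toNat, by omega⟩
        rw [hz, if_neg (by omega), smul_zero]
    have hspan : Submodule.span ℂ {k : L2 | ∃ h ∈ hardy, IsShiftedHankel u h k} = ⊥ := by
      rw [Submodule.span_eq_bot]
      rintro k ⟨h, hhh, g, hg, hk⟩
      apply ext_coeffL
      intro n
      rw [map_zero, coeffL_apply, hk.2]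
      split_ifs with hn
      · have e2 : (fun x => starRingEnd ℂ ((fourier 1 : C(Torus, ℂ)) x) * g x)
            = fun x => (fourier (-1 : ℤ) : C(Torus, ℂ)) x * g x := by
          ext x; rw [fourier_neg]
        have e1 : (fun x => u x * starRingEnd ℂ (h x)) =ᵐ[haarAddCircle]
            fun x => coeffL 0 u * starRingEnd ℂ (h x) := by
          rw [huc]
          filter_upwards [coe_toL2 (coeffL 0 u • (1 : C(Torus, ℂ)))] with x hx
          rw [hx, ← huc]
          simp
        rw [e2, fourierCoeff_fourier_mul, hg.2, fourierCoeff_congr_ae e1, fourierCoeff.const_mul,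
          fourierCoeff_conj, ← coeffL_apply, mem_hardy.mp hhh _ (by omega)]
        simp
      · rfl
    rw [hspan] at hv
    exact hv0 ((Submodule.mem_bot ℂ).mp hv)
  obtain ⟨a, ha⟩ := hcoef 0
  obtain ⟨a', ha'⟩ := hcoef 1
  have ha0 : a ≠ 0 := by
    rintro rfl
    exact hne fun n => by simpa using ha n
  have hpow : ∀ n : ℕ, coeffL (n + 1 : ℤ) u = coeffL 1 u * (a' / a) ^ n := by
    intro n
    induction n with
    | zero => simp
    | succ n ih =>
      have h1 := ha n
      have h2 := ha' n
      rw [Nat.cast_zero, add_zero] at h1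
      rw [Nat.cast_one] at h2
      rw [Nat.cast_succ, h2, pow_succ, ← mul_assoc, ← ih, h1]
      field_simp
  have hc0 : coeffL 1 u ≠ 0 := by
    intro h
    exact hne fun n => by rw [hpow, h, zero_mul]
  -- A ratio of modulus at least `1` would keep the coefficients away from `0`, against square
  -- summability.
  have hp : ‖a' / a‖ < 1 := by
    by_contra hp
    push Not at hp
    have hs := (hasSum_norm_sq_coeffL u).summable.comp_injective (i := fun n : ℕ => (n + 1 : ℤ))
      (fun m n h => by simpa using h)
    have ht := hs.tendsto_atTop_zero
    have : ‖coeffL 1 u‖ ^ 2 ≤ 0 := by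
      refine ge_of_tendsto ht (Eventually.of_forall fun n => ?_)
      simp only [Function.comp]
      rw [hpow, norm_mul, norm_pow]
      gcongr
      exact le_mul_of_one_le_right (norm_nonneg _) (one_le_pow₀ hp)
    have h2 : 0 < ‖coeffL 1 u‖ := norm_pos_iff.mpr hc0
    nlinarith
  refine ⟨coeffL 0 u, coeffL 1 u, a' / a, hc0, hp, ext_coeffL fun n => ?_⟩
  rcases lt_trichotomy n 0 with h | h | h
  · rw [mem_hardy.mp hh n h, mem_hardy.mp (ratFun_mem_hardy hp) n h]
  · rw [h, coeffL_ratFun_zero hp]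
  · obtain ⟨k, rfl⟩ : ∃ k : ℕ, n = k + 1 := ⟨(n - 1).toNat, by omega⟩
    rw [hpow, coeffL_ratFun_succ hp]

/-! ### Sobolev bounds from exponential decay of the Fourier coefficients -/

theorem summable_weight_mul_geometric (s D : ℝ) {R : ℝ} (hR0 : 0 < R) (hR : R < 1) :
    Summable fun n : ℤ => (1 + (n : ℝ) ^ 2) ^ s * (D * R ^ n.natAbs) ^ 2 := by
  have hR2 : ‖R ^ 2‖ < 1 := by
    rw [norm_pow, Real.norm_of_nonneg hR0.le]
    nlinarith
  have hnat : Summable fun n : ℕ => (1 + (n : ℝ) ^ 2) ^ s * (D * R ^ n) ^ 2 := by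
    obtain ⟨k, hk⟩ := exists_nat_ge s
    have h0 := summable_pow_mul_geometric_of_norm_lt_one (2 * k) hR2
    have h1 : Summable fun n : ℕ => ((n + 1 : ℕ) : ℝ) ^ (2 * k) * (R ^ 2) ^ (n + 1) :=
      h0.comp_injective (add_left_injective 1)
    refine Summable.of_nonneg_of_le (fun _ => by positivity) (fun n => ?_)
      (h1.mul_left (D ^ 2 / R ^ 2))
    have h2 : (1 + (n : ℝ) ^ 2) ^ s ≤ ((n + 1 : ℕ) : ℝ) ^ (2 * k) := by
      calc (1 + (n : ℝ) ^ 2) ^ s ≤ (1 + (n : ℝ) ^ 2) ^ (k : ℝ) :=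
            Real.rpow_le_rpow_of_exponent_le (by nlinarith [sq_nonneg (n : ℝ)]) hk
        _ = (1 + (n : ℝ) ^ 2) ^ k := Real.rpow_natCast _ _
        _ ≤ (((n + 1 : ℕ) : ℝ) ^ 2) ^ k := by
            gcongr
            push_cast
            nlinarith [Nat.cast_nonneg (α := ℝ) n]
        _ = _ := by rw [pow_mul]
    calc (1 + (n : ℝ) ^ 2) ^ s * (D * R ^ n) ^ 2
        ≤ ((n + 1 : ℕ) : ℝ) ^ (2 * k) * (D * R ^ n) ^ 2 := by gcongr
      _ = D ^ 2 / R ^ 2 * (((n + 1 : ℕ) : ℝ) ^ (2 * k) * (R ^ 2) ^ (n + 1)) := by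
          field_simp
          ring
  refine Summable.of_nat_of_neg ?_ ?_
  · simpa using hnat
  · simpa using hnat

/-- The Fourier coefficients of `u` decay like `D R^{|n|}`. -/
def HasDecay (D R : ℝ) (u : L2) : Prop := ∀ n : ℤ, ‖coeffL n u‖ ≤ D * R ^ n.natAbs

theorem HasDecay.sobolevNorm_eq {D R : ℝ} (hR0 : 0 < R) (hR : R < 1) {u : L2} (hu : HasDecay D R u)
    (s : ℝ) : (Summable fun n : ℤ => (1 + (n : ℝ) ^ 2) ^ s * ‖coeffL n u‖ ^ 2) ∧ sobolevNorm s u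
      = ENNReal.ofReal (Real.sqrt (∑' n : ℤ, (1 + (n : ℝ) ^ 2) ^ s * ‖coeffL n u‖ ^ 2)) := by
  have h : Summable fun n : ℤ => (1 + (n : ℝ) ^ 2) ^ s * ‖coeffL n u‖ ^ 2 :=
    Summable.of_nonneg_of_le (fun _ => by positivity)
      (fun n => by gcongr; exact hu n) (summable_weight_mul_geometric s D hR0 hR)
  exact ⟨h, AlphaSzego.sobolevNorm_eq h⟩

theorem HasDecay.sobolevNorm_le {D R : ℝ} (hR0 : 0 < R) (hR : R < 1) {u : L2} (hu : HasDecay D R u)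
    (s : ℝ) : sobolevNorm s u
      ≤ ENNReal.ofReal (Real.sqrt (∑' n : ℤ, (1 + (n : ℝ) ^ 2) ^ s * (D * R ^ n.natAbs) ^ 2)) := by
  obtain ⟨h1, h2⟩ := hu.sobolevNorm_eq hR0 hR s
  rw [h2]
  gcongr
  · exact summable_weight_mul_geometric s D hR0 hR
  · exact hu _

/-- Uniform geometric decay dominates the weighted series, so continuity in `L²` upgrades to
continuity in every `H^s`. -/
theorem HasDecay.tendsto_sobolevNorm_sub {D R : ℝ} (hR0 : 0 < R) (hR : R < 1) {u : ℝ → L2}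
    (hu : ∀ t, HasDecay D R (u t)) (hc : Continuous u) (s t₀ : ℝ) :
    Tendsto (fun t => sobolevNorm s (u t - u t₀)) (𝓝 t₀) (𝓝 0) := by
  have hd : ∀ t, HasDecay (2 * D) R (u t - u t₀) := by
    intro t n
    rw [map_sub]
    refine (norm_sub_le _ _).trans ?_
    linarith [hu t n, hu t₀ n]
  have h1 : Tendsto (fun t => ∑' n : ℤ, (1 + (n : ℝ) ^ 2) ^ s * ‖coeffL n (u t - u t₀)‖ ^ 2)
      (𝓝 t₀) (𝓝 (∑' _ : ℤ, (0 : ℝ))) := by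
    refine tendsto_tsum_of_dominated_convergence (summable_weight_mul_geometric s (2 * D) hR0 hR)
      (fun n => ?_) (Eventually.of_forall fun t n => ?_)
    · have hcn : Continuous fun t => (1 + (n : ℝ) ^ 2) ^ s * ‖coeffL n (u t - u t₀)‖ ^ 2 := by
        fun_prop
      have := hcn.tendsto t₀
      simpa using this
    · rw [Real.norm_of_nonneg (by positivity)]
      gcongr
      exact hd t n
  rw [tsum_zero] at h1
  have h2 := ENNReal.tendsto_ofReal h1.sqrt
  rw [Real.sqrt_zero, ENNReal.ofReal_zero] at h2
  refine h2.congr fun t => ?_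
  rw [((hd t).sobolevNorm_eq hR0 hR s).2]

theorem hasDecay_ratFun {b c p : ℂ} {R D : ℝ} (hR0 : 0 < R) (hR : R < 1) (hp : ‖p‖ ≤ R)
    (hb : ‖b‖ ≤ D) (hc : ‖c‖ ≤ D * R) : HasDecay D R (toL2 (ratFun (b, c, p))) := by
  have hp1 : ‖p‖ < 1 := hp.trans_lt hR
  have hD : 0 ≤ D := (norm_nonneg _).trans hb
  intro n
  rcases lt_trichotomy n 0 with h | h | h
  · rw [mem_hardy.mp (ratFun_mem_hardy hp1) n h, norm_zero]
    positivity
  · subst h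
    rw [coeffL_ratFun_zero hp1]
    simpa using hb
  · obtain ⟨k, rfl⟩ : ∃ k : ℕ, n = k + 1 := ⟨(n - 1).toNat, by omega⟩
    rw [coeffL_ratFun_succ hp1, norm_mul, norm_pow, show ((k : ℤ) + 1).natAbs = k + 1 by omega,
      pow_succ']
    calc ‖c‖ * ‖p‖ ^ k ≤ (D * R) * R ^ k := by gcongr
      _ = _ := by ring

/-! ### The explicit solution -/

/-- The equation is checked by matching the coefficients of `1`, `S` and `S²`, where `S = z/(1 -
pz)`; the derivative of `S` in `p` is `S²`, so this last coefficient governs the motion of `p`. -/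
theorem isGlobalSolution_ratFun {α l D R : ℝ} {γ : ℝ → ℂ × ℂ × ℂ} (hR0 : 0 < R) (hR : R < 1)
    (hγ : ∀ t, HasDerivAt γ (field α l (γ t)) t) (hb : ∀ t, ‖(γ t).1‖ ≤ D)
    (hcD : ∀ t, ‖(γ t).2.1‖ ≤ D * R) (hp : ∀ t, ‖(γ t).2.2‖ ≤ R)
    (hc : ∀ t, ‖(γ t).2.1‖ = l * (1 - ‖(γ t).2.2‖ ^ 2)) :
    IsGlobalSolution α (toL2 (ratFun (γ 0))) (fun t => toL2 (ratFun (γ t))) := by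
  have hp1 : ∀ t, ‖(γ t).2.2‖ < 1 := fun t => (hp t).trans_lt hR
  have hdec : ∀ t, HasDecay D R (toL2 (ratFun (γ t))) := fun t =>
    hasDecay_ratFun hR0 hR (hp t) (hb t) (hcD t)
  have hder : ∀ t, HasDerivAt (fun t => toL2 (ratFun (γ t)))
      (toL2 ((field α l (γ t)).1 • (1 : C(Torus, ℂ))
        + (field α l (γ t)).2.1 • shiftKernel (γ t).2.2
        + ((γ t).2.1 * (field α l (γ t)).2.2) • shiftKernel (γ t).2.2 ^ 2)) t := fun t =>
    (toL2.restrictScalars ℝ).hasFDerivAt.comp_hasDerivAt t (hasDerivAt_ratFun (hγ t) (hp1 t))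
  have hcont : Continuous fun t => toL2 (ratFun (γ t)) :=
    continuous_iff_continuousAt.mpr fun t => (hder t).continuousAt
  refine ⟨fun t => ⟨ratFun_mem_hardy (hp1 t), ?_⟩,
    fun t₀ => HasDecay.tendsto_sobolevNorm_sub hR0 hR hdec hcont _ t₀, fun t => ?_, rfl⟩
  · rw [((hdec t).sobolevNorm_eq hR0 hR _).2]
    exact ENNReal.ofReal_lt_top
  · refine ⟨toL2 (ratCubic l (γ t)), _, isSzegoProj_ratCubic (hp1 t) (hc t), hder t, ?_⟩
    have hmean : mean (toL2 (ratFun (γ t))) = (γ t).1 := by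
      rw [mean_eq]; exact coeffL_ratFun_zero (hp1 t)
    rw [hmean, coe_one, ← map_smul, ← map_smul, ← map_add]
    congr 1
    ext x
    simp only [field, ratCubic, ContinuousMap.add_apply, ContinuousMap.smul_apply,
      ContinuousMap.one_apply, ContinuousMap.pow_apply, smul_eq_mul, mul_one]
    linear_combination (-(1 : ℂ)) * (
      ((γ t).1 * starRingEnd ℂ (γ t).1 * (γ t).1
        + 2 * (l : ℂ) ^ 2 * (1 - (γ t).2.2 * starRingEnd ℂ (γ t).2.2) * (γ t).1
        + (l : ℂ) ^ 2 * (γ t).2.1 * starRingEnd ℂ (γ t).2.2 + α * (γ t).1)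
      + (2 * (γ t).1 * starRingEnd ℂ (γ t).1 * (γ t).2.1 + (l : ℂ) ^ 2 * (γ t).2.1
        + 2 * (l : ℂ) ^ 2 * (1 - (γ t).2.2 * starRingEnd ℂ (γ t).2.2) * (γ t).1 * (γ t).2.2)
        * shiftKernel (γ t).2.2 x
      + (γ t).2.1 * (starRingEnd ℂ (γ t).1 * (γ t).2.1
        + (l : ℂ) ^ 2 * (1 - (γ t).2.2 * starRingEnd ℂ (γ t).2.2) * (γ t).2.2)
        * shiftKernel (γ t).2.2 x ^ 2) * Complex.I_mul_I

theorem norm_toL2_ratFun_le {b c p : ℂ} {R D : ℝ} (hR : R < 1) (hp : ‖p‖ ≤ R)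
    (hb : ‖b‖ ≤ D) (hc : ‖c‖ ≤ D * R) :
    ∀ᵐ x ∂haarAddCircle, ‖toL2 (ratFun (b, c, p)) x‖ ≤ D + D * R / (1 - R) := by
  filter_upwards [coe_toL2 (ratFun (b, c, p))] with x hx
  rw [hx, ratFun_apply (hp.trans_lt hR)]
  have hR1 : 0 < 1 - R := by linarith
  have h1 : 1 - R ≤ ‖1 - p * (fourier 1 : C(Torus, ℂ)) x‖ := by
    have := norm_sub_norm_le 1 (p * (fourier 1 : C(Torus, ℂ)) x)
    rw [norm_mul, norm_fourier_apply, norm_one, mul_one] at this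
    linarith
  refine (norm_add_le _ _).trans (add_le_add hb ?_)
  rw [norm_div, norm_mul, norm_fourier_apply, mul_one]
  have : 0 ≤ D * R := (norm_nonneg c).trans hc
  gcongr

/-- The two sides are equal, by `∑ (n + 2) rⁿ = 1/(1 - r) + 1/(1 - r)²` with `r = |p|²`. The energy
thus controls both `Q` and `l²`. -/
theorem ratFun_energy_ge {b c p : ℂ} (hp : ‖p‖ < 1) (he : HasEnergy (toL2 (ratFun (b, c, p)))) :
    ‖b‖ ^ 2 + ‖c‖ ^ 2 / (1 - ‖p‖ ^ 2) + (‖c‖ / (1 - ‖p‖ ^ 2)) ^ 2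
      ≤ energy (toL2 (ratFun (b, c, p))) := by
  have hr : ‖‖p‖ ^ 2‖ < 1 := by
    rw [norm_pow, norm_norm]; nlinarith [norm_nonneg p]
  have hr1 : 1 - ‖p‖ ^ 2 ≠ 0 := by nlinarith [norm_nonneg p]
  have h1 := (hasSum_coe_mul_geometric_of_norm_lt_one hr).add
    ((hasSum_geometric_of_norm_lt_one hr).mul_left 2)
  have h2 := h1.mul_left (‖c‖ ^ 2)
  have h3 : energy (toL2 (ratFun (b, c, p))) = ‖b‖ ^ 2
      + ∑' n : ℕ, ‖c‖ ^ 2 * ((n : ℝ) * (‖p‖ ^ 2) ^ n + 2 * (‖p‖ ^ 2) ^ n) := by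
    rw [energy, he.tsum_eq_zero_add, Nat.cast_zero, Nat.cast_zero, coeffL_ratFun_zero hp]
    congr 1
    · ring
    · refine tsum_congr fun n => ?_
      have : coeffL ((n + 1 : ℕ) : ℤ) (toL2 (ratFun (b, c, p))) = c * p ^ n := by
        push_cast; exact coeffL_ratFun_succ hp n
      rw [this, norm_mul, norm_pow, mul_pow, ← pow_mul, ← pow_mul, mul_comm n 2]
      push_cast
      ring
  rw [h3, h2.tsum_eq]
  apply le_of_eq
  field_simp
  ring

end AlphaSzego

end

/-! ### Assembly of the theorem. -/

theorem mainTheorem8 :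
    ∃ δ : ℝ, 0 < δ ∧ ∀ α : ℝ, 0 < α → ∀ u₀ : AlphaSzego.L2, u₀ ∈ AlphaSzego.calL 1 →
      AlphaSzego.sobolevNorm (1 / 2) u₀ ≤ ENNReal.ofReal (δ * Real.sqrt α) →
        (∃! u : ℝ → AlphaSzego.L2, AlphaSzego.IsGlobalSolution α u₀ u) ∧
        ∀ u : ℝ → AlphaSzego.L2, AlphaSzego.IsGlobalSolution α u₀ u →
          (∀ t : ℝ, ∃ b c p : ℂ, c ≠ 0 ∧ ‖p‖ < 1 ∧ AlphaSzego.IsRational (u t) b c p ∧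
            ‖b + starRingEnd ℂ p * c / (1 - (‖p‖ : ℂ) ^ 2)‖ ≠ Real.sqrt α) ∧
          (∀ s : ℝ, ∃ C : NNReal, ∀ t : ℝ, AlphaSzego.sobolevNorm s (u t) ≤ (C : ENNReal)) := by
  open AlphaSzego in
  -- With `δ = 1/8` the energy is at most `2δ²α = α/32`, within the threshold `α/16` required of
  -- both `l²` and `Q`.
  refine ⟨1 / 8, by norm_num, fun α hα u₀ hu₀ hsmall => ?_⟩
  obtain ⟨b₀, c₀, p₀, hc₀, hp₀, rfl⟩ := exists_ratFun_of_mem_calL hu₀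
  have he := energy_le_of_sobolevNorm (by positivity) hsmall
  rw [mul_pow, Real.sq_sqrt hα.le] at he
  have hge := (ratFun_energy_ge hp₀ (hasEnergy_of_sobolevNorm_lt_top hu₀.1.2)).trans he
  have hx₀ : 0 < 1 - ‖p₀‖ ^ 2 := by nlinarith [norm_nonneg p₀]
  have hx₁ : 1 - ‖p₀‖ ^ 2 ≤ 1 := by nlinarith [norm_nonneg p₀]
  have hcn : 0 < ‖c₀‖ := norm_pos_iff.mpr hc₀
  obtain ⟨l, hl⟩ : ∃ l, l = ‖c₀‖ / (1 - ‖p₀‖ ^ 2) := ⟨_, rfl⟩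
  have hlpos : 0 < l := by rw [hl]; positivity
  have hcl : ‖c₀‖ = l * (1 - ‖p₀‖ ^ 2) := by rw [hl]; field_simp
  obtain ⟨Q, hQ⟩ : ∃ Q, ‖b₀‖ ^ 2 + l ^ 2 * (1 - ‖p₀‖ ^ 2) = Q := ⟨_, rfl⟩
  have hQ' : ‖b₀‖ ^ 2 + ‖c₀‖ ^ 2 / (1 - ‖p₀‖ ^ 2) = Q := by
    rw [← hQ, hl]; field_simp
  rw [hQ', ← hl] at hge
  have hQ0 : 0 ≤ Q := by rw [← hQ]; positivity
  have hl2 : l ^ 2 ≤ α / 16 := by linarith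
  have hQ2 : Q ≤ α / 16 := by nlinarith [sq_nonneg l]
  obtain ⟨γ, h0, hγ, hb⟩ := exists_reduced_solution hα hlpos hl2 hQ2 hp₀ hcl hQ
  -- The lower bound `x(t) ≥ x(0)/3` says exactly that `|p(t)| ≤ R`.
  set R := Real.sqrt (1 - (1 - ‖p₀‖ ^ 2) / 3) with hRdef
  have hR0 : 0 < R := Real.sqrt_pos.mpr (by linarith)
  have hR1 : R < 1 := by
    rw [hRdef, Real.sqrt_lt' one_pos]
    linarith
  have hxt : ∀ t, 0 < 1 - ‖(γ t).2.2‖ ^ 2 := fun t => by linarith [(hb t).1]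
  have hpt : ∀ t, ‖(γ t).2.2‖ ≤ R := fun t => Real.le_sqrt_of_sq_le (by linarith [(hb t).1])
  have hpt1 : ∀ t, ‖(γ t).2.2‖ < 1 := fun t => (hpt t).trans_lt hR1
  have hbQ : ∀ t, ‖(γ t).1‖ ^ 2 ≤ Q := fun t => by
    have := mul_pos (pow_pos hlpos 2) (hxt t)
    linarith [(hb t).2.2]
  have hct : ∀ t, ‖(γ t).2.1‖ = l * (1 - ‖(γ t).2.2‖ ^ 2) := fun t => (hb t).2.1
  -- Division by `R` accounts for the index shift: the coefficient of `z^{k+1}` is `c p^k`, so `D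
  -- R^{k+1}` dominates it once `|c| ≤ D R`.
  set D := (Q + l + 1) / R with hD
  have hbD : ∀ t, ‖(γ t).1‖ ≤ D := fun t => by
    rw [hD, le_div_iff₀ hR0]
    calc ‖(γ t).1‖ * R ≤ ‖(γ t).1‖ * 1 := by gcongr
      _ ≤ Q + l + 1 := by nlinarith [hbQ t, sq_nonneg (‖(γ t).1‖ - 1)]
  have hcD : ∀ t, ‖(γ t).2.1‖ ≤ D * R := fun t => by
    rw [hD, div_mul_cancel₀ _ hR0.ne', hct t]
    nlinarith [sq_nonneg ‖(γ t).2.2‖]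
  have hsol := isGlobalSolution_ratFun hR0 hR1 hγ hbD hcD hpt hct
  rw [h0] at hsol
  have huniq : ∀ u, IsGlobalSolution α (toL2 (ratFun (b₀, c₀, p₀))) u →
      u = fun t => toL2 (ratFun (γ t)) := fun u hu =>
    hu.unique hsol fun t => norm_toL2_ratFun_le hR1 (hpt t) (hbD t) (hcD t)
  refine ⟨⟨_, hsol, huniq⟩, fun u hu => ?_⟩
  rw [huniq u hu]
  refine ⟨fun t => ⟨(γ t).1, (γ t).2.1, (γ t).2.2, ?_, hpt1 t, isRational_toL2 (hpt1 t), ?_⟩,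
    fun s => ⟨_, fun t =>
      (hasDecay_ratFun hR0 hR1 (hpt t) (hbD t) (hcD t)).sobolevNorm_le hR0 hR1 s⟩⟩
  · rw [← norm_pos_iff, hct t]
    exact mul_pos hlpos (hxt t)
  -- Both summands of `u(p̄)` are at most `√α/4`: the first since `|b|² ≤ Q`, the second since its
  -- modulus is `|p| l`.
  · apply ne_of_lt
    have hs : 0 < Real.sqrt α := Real.sqrt_pos.mpr hα
    have hsq := Real.sq_sqrt hα.le
    have h1 : ‖(γ t).1‖ ≤ Real.sqrt α / 4 :=
      le_of_sq_le_sq (by nlinarith [hbQ t]) (by positivity)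
    have h2 : l ≤ Real.sqrt α / 4 := le_of_sq_le_sq (by nlinarith) (by positivity)
    have h3 : ‖starRingEnd ℂ (γ t).2.2 * (γ t).2.1 / (1 - (‖(γ t).2.2‖ : ℂ) ^ 2)‖ ≤ l := by
      have e : (1 - (‖(γ t).2.2‖ : ℂ) ^ 2) = ((1 - ‖(γ t).2.2‖ ^ 2 : ℝ) : ℂ) := by push_cast; rfl
      rw [e, norm_div, norm_mul, RCLike.norm_conj, Complex.norm_real, Real.norm_of_nonneg (hxt t).le,
        div_le_iff₀ (hxt t), hct t]
      have := mul_pos hlpos (hxt t)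
      nlinarith [hpt1 t]
    calc _ ≤ ‖(γ t).1‖ + _ := norm_add_le _ _
      _ < Real.sqrt α := by linarith
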